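/- Let $(R,\mathfrak m,K)$ be a Noetherian local domain of prime characteristic $p$ whose residue field $K=R/\mathfrak m$ is algebraically closed. For an ideal $\mathfrak a$ of a ring of characteristic $p$ and $q=p^k$, let $\mathfrak a^{[q]}$ be the ideal generated by the $q$-th powers of the elements of $\mathfrak a$, and let $\lambda$ denote length. For a Noetherian local ring $(A,\mathfrak m_A)$ of characteristic $p$ and dimension $d$ put $$e_{HK}(A)=\lim_{q\to\infty}\frac{\lambda_A(A/\mathfrak m_A^{[q]})}{q^d},\qquad e_{HK}(\mathfrak a,\mathfrak b)=\lim_{q\to\infty}\frac{\lambda_A(\mathfrak b^{[q]}/\mathfrak a^{[q]})}{q^d}$$ for ideals $\mathfrak a\subseteq \mathfrak b$ of $A$ with $\lambda_A(\mathfrak b/\mathfrak a)<\infty$. Let $z\in\mathfrak m$, let $n\ge 2$ be an integer, and let $S=R[v]$ be a radical extension for $R,z$: a domain that is an extension of $R$ generated as an $R$-algebra by an element $v$ with $v^n=z$. The ring $S$ is local. Let $b=[\operatorname{ff}(S):\operatorname{ff}(R)]$ be the degree of the extension of fraction fields. Let $I\subseteq R$ be an ideal with $z\notin I$ and $\mathfrak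 m=(z)+I$. Let $r\in R$, let $I_0$ be an ideal of $R$, and suppose that $J=(zr)+I_0$ satisfies $\lambda_R(J/I_0)=1$ and that $vrIS\subseteq I_0S$. Then all the lengths $\lambda_R(J^{[q]}/I_0^{[q]})$, $\lambda_R(R/\mathfrak m^{[q]})$, $\lambda_S(S/\mathfrak n^{[q]})$ (with $\mathfrak n$ the maximal ideal of $S$) are finite, the limits $e_{HK}(I_0,J)$, $e_{HK}(R)$ and $e_{HK}(S)$ exist as real numbers, and $$e_{HK}(I_0,J)\le \frac{n}{n-1}\,e_{HK}(R)-\frac{n}{b(n-1)}\,e_{HK}(S).$$ -/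

import Mathlib

open Filter Topology

noncomputable section

/-- The Frobenius power `I^{[q]}`: the ideal generated by the `q`-th powers of the elements
of `I`. -/
def frobPower {R : Type*} [CommRing R] (I : Ideal R) (q : ℕ) : Ideal R :=
  Ideal.span ((fun x : R => x ^ q) '' (I : Set R))

/-- The length `λ_R(J / I)` of the quotient of an ideal `J` by an ideal `I ⊆ J`
(for arbitrary `I`, `J` this is the length of `J / (I ∩ J)`). -/
def idealQuotLength {R : Type*} [CommRing R] (I J : Ideal R) : ℕ∞ :=
  Module.length R (↥J ⧸ Submodule.submoduleOf I J)

/-- The Krull dimension as a natural number; it is finite for Noetherian local rings. -/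
def natKrullDim (R : Type*) [CommRing R] : ℕ :=
  ((ringKrullDim R).unbotD 0).toNat

/-- `e` is the relative Hilbert-Kunz multiplicity `e_HK(I, J)` of the ideals `I ⊆ J` of a local
ring of characteristic `p` and dimension `d`: all lengths `λ(J^{[q]} / I^{[q]})`, `q = p ^ k`,
are finite, and `e = lim_{q → ∞} λ(J^{[q]} / I^{[q]}) / q ^ d`. -/
def IsRelHilbertKunzMultiplicity (p : ℕ) {R : Type*} [CommRing R] (I J : Ideal R) (e : ℝ) :
    Prop :=
  (∀ k : ℕ, idealQuotLength (frobPower I (p ^ k)) (frobPower J (p ^ k)) ≠ ⊤) ∧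
    Tendsto
      (fun k : ℕ =>
        ((idealQuotLength (frobPower I (p ^ k)) (frobPower J (p ^ k))).toNat : ℝ) /
          ((p : ℝ) ^ k) ^ natKrullDim R)
      atTop (𝓝 e)

/-- `e` is the Hilbert-Kunz multiplicity `e_HK(R)` of the local ring `R` with maximal ideal `m`:
all lengths `λ(R / m^{[q]})`, `q = p ^ k`, are finite, and
`e = lim_{q → ∞} λ(R / m^{[q]}) / q ^ d` with `d = dim R`. -/
def IsHilbertKunzMultiplicity (p : ℕ) (R : Type*) [CommRing R] [IsLocalRing R] (e : ℝ) : Prop :=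
  (∀ k : ℕ, Module.length R (R ⧸ frobPower (IsLocalRing.maximalIdeal R) (p ^ k)) ≠ ⊤) ∧
    Tendsto
      (fun k : ℕ =>
        ((Module.length R (R ⧸ frobPower (IsLocalRing.maximalIdeal R) (p ^ k))).toNat : ℝ) /
          ((p : ℝ) ^ k) ^ natKrullDim R)
      atTop (𝓝 e)

/-- `S = R[v]` is a radical extension for the pair `R`, `z`: `z` lies in the maximal ideal of the
local domain `R`, and `S` is a domain that extends `R` and is generated as an `R`-algebra by a root
`v` of `X ^ n - z`, where `n` is positive. (Such an `S` is integral over `R`, so up to isomorphism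
it is a subring of the integral closure `R⁺` of `R` in an algebraic closure of its fraction
field.) -/
structure IsRadicalExtension {R : Type*} [CommRing R] [IsDomain R] [IsLocalRing R]
    {S : Type*} [CommRing S] [IsDomain S] [Algebra R S] (z : R) (n : ℕ) (v : S) : Prop where
  injective : Function.Injective (algebraMap R S)
  mem_maximalIdeal : z ∈ IsLocalRing.maximalIdeal R
  pos : 0 < n
  pow_eq : v ^ n = algebraMap R S z
  adjoin_eq_top : Algebra.adjoin R {v} = ⊤

/-- The degree `[ff(S) : ff(R)]` of the extension of fraction fields induced by an injective
homomorphism `R → S` of domains. -/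
def fracDegree (R S : Type*) [CommRing R] [IsDomain R] [CommRing S] [IsDomain S] [Algebra R S]
    (h : Function.Injective (algebraMap R S)) : ℕ :=
  letI : Algebra (FractionRing R) (FractionRing S) :=
    (IsFractionRing.map (K := FractionRing R) (L := FractionRing S) h).toAlgebra
  Module.finrank (FractionRing R) (FractionRing S)

end

/-! For an ideal `𝔞` and an element `c`, multiplication by `c` gives `((c) + 𝔞)/𝔞 ≅ R/(𝔞 : c)`. So
`λ(J^{[q]}/I₀^{[q]})` is the colength of `(I₀^{[q]} : w^q)` with `w = zr`, and `λ(R/m^{[q]})` is the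
case `w = 1`, `I₀ = m`. Both are treated at once by `colonLen`, with coefficients in a module. The
only hypothesis needed is `w m ⊆ I₀`, which follows from `λ(J/I₀) = 1` and bounds the colon length
by `λ(M/m^{[q]}M) = O(q^d)`.

Inequality (`colonLen_radical_le`). In `S` put `x = v^q`, `ρ = r^q`, `𝔦 = (IS)^{[q]}`, `𝔧 =
(I₀S)^{[q]}`, so that `xρ𝔦 ⊆ 𝔧` and `x^{2n}ρ ∈ 𝔧`. Let `L i` be the colength of `(𝔧 : x^i ρ)` and `H
i` that of `(x^i) + 𝔦`. The drops `g i` of `L` and the increments `h i` of `H` are both decreasing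
in `i`, and `g (i+1) ≤ h i`. Hence `L n ≤ n · g n ≤ n · h (n-1)`, while `H n ≥ H 1 + (n-1) · h
(n-1)`, so `(n-1) L n + n H 1 ≤ n H n`. Here `H 1 = λ(S/n^{[q]})`, and `H n`, `L n` are the lengths
defining `e_HK(R)` and `e_HK(I₀, J)` with coefficients in `S`. As an `R`-module `S` has rank `b`, so
after division by `q^d` they tend to `b` times these multiplicities.

Existence of the limits (`exists_tendsto_normLen`). Flat base change to the completion preserves
colon lengths. Over a complete local ring with perfect residue field Frobenius is finite. Maps in
both directions with cokernels of smaller dimension change normalized lengths by `O(1/q)` only. An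
iterated Frobenius pushforward is killed by the nilradical, which reduces the question to `B/P` with
`P` a minimal prime. There the rank of the Frobenius pushforward gives a linear recursion for the
normalized lengths, and with boundedness this forces convergence. -/

/-! ### Colon lengths, Frobenius powers and change of rings -/

section ColonLength

open Submodule

variable {B : Type*} [CommRing B]

/-- The submodule `{x | c • x ∈ 𝔞 M}` of `M`. -/
def colonSub (𝔞 : Ideal B) (c : B) (M : Type*) [AddCommGroup M] [Module B M] : Submodule B M :=
  (𝔞 • (⊤ : Submodule B M)).comap (LinearMap.lsmul B M c)

/-- The length of `M / (𝔞 M : c)`, which is the length of `(c M + 𝔞 M) / 𝔞 M`. -/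
noncomputable def colonLen (𝔞 : Ideal B) (c : B) (M : Type*) [AddCommGroup M] [Module B M] : ℕ∞ :=
  Module.length B (M ⧸ colonSub 𝔞 c M)

variable {M N : Type*} [AddCommGroup M] [Module B M] [AddCommGroup N] [Module B N]

lemma mem_colonSub {𝔞 : Ideal B} {c : B} {x : M} :
    x ∈ colonSub 𝔞 c M ↔ c • x ∈ 𝔞 • (⊤ : Submodule B M) := Iff.rfl

lemma mem_colonSub_self {𝔞 : Ideal B} {c x : B} : x ∈ colonSub 𝔞 c B ↔ c * x ∈ 𝔞 := by
  rw [mem_colonSub, smul_eq_mul, smul_eq_mul, Ideal.mul_top]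

lemma length_quotient_le_of_le {P Q : Submodule B M} (h : P ≤ Q) :
    Module.length B (M ⧸ Q) ≤ Module.length B (M ⧸ P) :=
  Module.length_le_of_surjective (Submodule.factor h) (Submodule.factor_surjective h)

/-- The map `M/α⁻¹Q → N/Q` is injective with cokernel `N/(im α + Q)`. Most length comparisons below
are instances of this. -/
lemma length_quotient_eq_comap_add (α : M →ₗ[B] N) (Q : Submodule B N) :
    Module.length B (N ⧸ Q) =
      Module.length B (M ⧸ Q.comap α) + Module.length B (N ⧸ (LinearMap.range α ⊔ Q)) := by
  have hle : Q ≤ LinearMap.range α ⊔ Q := le_sup_right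
  refine (Module.length_eq_add_of_exact ((Q.comap α).mapQ Q α le_rfl) (Submodule.factor hle)
    ?_ (Submodule.factor_surjective hle) ?_)
  · rw [← LinearMap.ker_eq_bot, Submodule.ker_mapQ]
    simp
  · rw [LinearMap.exact_iff]
    ext x
    obtain ⟨x, rfl⟩ := Submodule.Quotient.mk_surjective _ x
    have hker : Submodule.factor hle (Submodule.Quotient.mk x) = 0 ↔
        x ∈ LinearMap.range α ⊔ Q := Submodule.Quotient.mk_eq_zero _
    rw [LinearMap.mem_ker, hker]
    constructor
    · intro hx
      obtain ⟨y, ⟨m, rfl⟩, z, hz, rfl⟩ := Submodule.mem_sup.mp hx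
      refine ⟨Submodule.Quotient.mk m, ?_⟩
      rw [Submodule.mapQ_apply, Submodule.Quotient.eq]
      simpa using hz
    · rintro ⟨m, hm⟩
      obtain ⟨m, rfl⟩ := Submodule.Quotient.mk_surjective _ m
      rw [Submodule.mapQ_apply, Submodule.Quotient.eq] at hm
      have := sub_mem (mem_sup_left (T := Q) (LinearMap.mem_range_self α m)) (mem_sup_right hm)
      simpa using this

lemma smul_top_le_colonSub {𝔞 𝔟 : Ideal B} {c : B} (h : ∀ x ∈ 𝔟, c * x ∈ 𝔞) :
    𝔟 • (⊤ : Submodule B M) ≤ colonSub 𝔞 c M := by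
  rw [Submodule.smul_le]
  intro b hb x _
  rw [mem_colonSub, smul_smul]
  exact Submodule.smul_mem_smul (h b hb) trivial

lemma colonLen_le_length {𝔞 𝔟 : Ideal B} {c : B} (h : ∀ x ∈ 𝔟, c * x ∈ 𝔞) :
    colonLen 𝔞 c M ≤ Module.length B (M ⧸ 𝔟 • (⊤ : Submodule B M)) :=
  length_quotient_le_of_le (smul_top_le_colonSub h)

/-- Since `α` carries `(𝔞M : c)` into `(𝔞N : c)`, and `𝔟N ⊆ (𝔞N : c)`, the only loss is the cokernel
of `α` modulo `𝔟`. -/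
lemma colonLen_le_add {𝔞 𝔟 : Ideal B} {c : B} (h : ∀ x ∈ 𝔟, c * x ∈ 𝔞) (α : M →ₗ[B] N) :
    colonLen 𝔞 c N ≤ colonLen 𝔞 c M +
      Module.length B (N ⧸ (LinearMap.range α ⊔ 𝔟 • (⊤ : Submodule B N))) := by
  refine (length_quotient_eq_comap_add α _).le.trans (add_le_add ?_ ?_)
  · refine length_quotient_le_of_le fun x hx => ?_
    rw [Submodule.mem_comap, mem_colonSub, ← map_smul]
    have : α (c • x) ∈ (𝔞 • (⊤ : Submodule B M)).map α := Submodule.mem_map_of_mem hx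
    rw [Submodule.map_smul''] at this
    exact Submodule.smul_mono le_rfl le_top this
  · exact length_quotient_le_of_le (sup_le_sup_left (smul_top_le_colonSub h) _)

lemma ideal_smul_top_pi {ι : Type*} [Finite ι] (𝔞 : Ideal B) (M : ι → Type*)
    [∀ i, AddCommGroup (M i)] [∀ i, Module B (M i)] :
    𝔞 • (⊤ : Submodule B (∀ i, M i)) =
      Submodule.pi Set.univ fun i => 𝔞 • (⊤ : Submodule B (M i)) := by
  classical
  apply le_antisymm
  · rw [Submodule.smul_le]
    intro b hb x _ i _
    exact Submodule.smul_mem_smul hb trivial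
  · intro x hx
    cases nonempty_fintype ι
    rw [← Finset.univ_sum_single x]
    refine Submodule.sum_mem _ fun i _ => ?_
    have : LinearMap.single B M i (x i) ∈
        (𝔞 • (⊤ : Submodule B (M i))).map (LinearMap.single B M i) :=
      Submodule.mem_map_of_mem (hx i trivial)
    rw [Submodule.map_smul''] at this
    exact Submodule.smul_mono le_rfl le_top this

lemma colonSub_pi {ι : Type*} [Finite ι] (𝔞 : Ideal B) (c : B) (M : ι → Type*)
    [∀ i, AddCommGroup (M i)] [∀ i, Module B (M i)] :
    colonSub 𝔞 c (∀ i, M i) = Submodule.pi Set.univ fun i => colonSub 𝔞 c (M i) := by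
  ext x
  rw [mem_colonSub, ideal_smul_top_pi]
  rfl

lemma colonLen_pi {ι : Type*} [Fintype ι] (𝔞 : Ideal B) (c : B) (M : ι → Type*)
    [∀ i, AddCommGroup (M i)] [∀ i, Module B (M i)] :
    colonLen 𝔞 c (∀ i, M i) = ∑ i, colonLen 𝔞 c (M i) := by
  classical
  unfold colonLen
  rw [← Module.length_pi_of_fintype, colonSub_pi]
  exact (Submodule.quotientPi _).length_eq

end ColonLength

section FrobeniusPower

/-- With this, functoriality of `Ideal.map` replaces computations with generators. -/
lemma frobPower_eq_map (p : ℕ) {R : Type*} [CommRing R] [ExpChar R p] (I : Ideal R) (k : ℕ) :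
    frobPower I (p ^ k) = I.map (iterateFrobenius R p k) := rfl

end FrobeniusPower

section Restrict

variable {A D : Type*} [CommRing A] [CommRing D] [Algebra A D] {M : Type*} [AddCommGroup M]
  [Module A M] [Module D M] [IsScalarTower A D M]

lemma colonSub_map (𝔞 : Ideal A) (c : A) :
    (colonSub (𝔞.map (algebraMap A D)) (algebraMap A D c) M).restrictScalars A =
      colonSub 𝔞 c M := by
  ext x
  rw [Submodule.restrictScalars_mem, mem_colonSub, mem_colonSub, algebraMap_smul]
  have : (𝔞 • (⊤ : Submodule A M)) =
      ((𝔞.map (algebraMap A D)) • (⊤ : Submodule D M)).restrictScalars A :=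
    (Ideal.smul_restrictScalars 𝔞 (⊤ : Submodule D M)).symm
  rw [this, Submodule.restrictScalars_mem]

variable [IsLocalRing A] [IsLocalRing D]

/-- The two lengths differ by the degree of the residue field extension, which is one by `hres`. -/
lemma length_restrictScalars_eq_of_residue (hloc : IsLocalHom (algebraMap A D))
    (hres : ∀ x : D, ∃ a : A, x - algebraMap A D a ∈ IsLocalRing.maximalIdeal D) :
    Module.length A M = Module.length D M := by
  rw [IsLocalRing.length_restrictScalars A D M]
  have : Function.Surjective
      (algebraMap (IsLocalRing.ResidueField A) (IsLocalRing.ResidueField D)) := by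
    intro y
    obtain ⟨x, rfl⟩ := IsLocalRing.residue_surjective y
    obtain ⟨a, ha⟩ := hres x
    refine ⟨IsLocalRing.residue A a, ?_⟩
    rw [IsLocalRing.ResidueField.algebraMap_residue]
    symm
    rw [← sub_eq_zero, ← map_sub, IsLocalRing.residue_eq_zero_iff]
    exact ha
  rw [Module.length_eq_of_surjective (M := IsLocalRing.ResidueField D) this,
    Module.length_eq_one (IsLocalRing.ResidueField D) (IsLocalRing.ResidueField D), mul_one]

lemma colonLen_map (hloc : IsLocalHom (algebraMap A D))
    (hres : ∀ x : D, ∃ a : A, x - algebraMap A D a ∈ IsLocalRing.maximalIdeal D)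
    (𝔞 : Ideal A) (c : A) :
    colonLen 𝔞 c M = colonLen (𝔞.map (algebraMap A D)) (algebraMap A D c) M := by
  unfold colonLen
  rw [← length_restrictScalars_eq_of_residue hloc hres, ← colonSub_map (D := D)]
  exact ((Submodule.Quotient.restrictScalarsEquiv A _).length_eq)

end Restrict

/-! ### Growth of lengths and dimension -/

section LengthGrowth

open scoped Pointwise

variable {B : Type*} [CommRing B] {M : Type*} [AddCommGroup M] [Module B M]

/-- Each layer `y^i M / y^{i+1} M` modulo `Q` is a quotient of `M/(yM + Q)` through multiplication
by `y^i`. -/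
lemma length_quotient_pow_smul_sup_le (y : B) (Q : Submodule B M) (q : ℕ) :
    Module.length B (M ⧸ (y ^ q • (⊤ : Submodule B M) ⊔ Q)) ≤
      q * Module.length B (M ⧸ (y • (⊤ : Submodule B M) ⊔ Q)) := by
  induction q with
  | zero => 
    have : y ^ 0 • (⊤ : Submodule B M) ⊔ Q = ⊤ := by simp
    rw [this]
    simp [Module.length_eq_zero]
  | succ q ih =>
    rw [length_quotient_eq_comap_add (LinearMap.lsmul B M (y ^ q)) _]
    push_cast
    rw [add_mul, one_mul, add_comm]
    refine add_le_add (le_trans (length_quotient_le_of_le ?_) ih) (length_quotient_le_of_le ?_)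
    · refine sup_le ?_ (le_sup_of_le_right le_sup_right)
      refine le_sup_of_le_left ?_
      rintro _ ⟨x, -, rfl⟩
      exact ⟨x, rfl⟩
    · refine sup_le ?_ fun x hx => ?_
      · rintro _ ⟨x, -, rfl⟩
        refine Submodule.mem_sup_left ⟨x, trivial, ?_⟩
        simp [pow_succ, mul_smul, smul_comm y (y ^ q) x]
      · exact Submodule.mem_sup_right (Q.smul_mem _ hx)

/-- Generators are treated one at a time; `Q` is arbitrary so that it can absorb the remaining one.
-/
lemma length_quotient_span_pow_le (s : Finset B) (q : ℕ) (Q : Submodule B M) :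
    Module.length B (M ⧸ (Ideal.span ((· ^ q) '' (s : Set B)) • (⊤ : Submodule B M) ⊔ Q)) ≤
      (q : ℕ∞) ^ s.card * 
        Module.length B (M ⧸ (Ideal.span (s : Set B) • (⊤ : Submodule B M) ⊔ Q)) := by
  classical
  induction s using Finset.induction_on generalizing Q with
  | empty => rw [Finset.coe_empty, Set.image_empty]; simp
  | insert y s hy ih =>
    have key : ∀ (z : B) (T : Set B), Ideal.span (insert z T) • (⊤ : Submodule B M) ⊔ Q =
        Ideal.span T • (⊤ : Submodule B M) ⊔ (z • (⊤ : Submodule B M) ⊔ Q) := by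
      intro z T
      rw [Ideal.span_insert, Submodule.sup_smul, Submodule.ideal_span_singleton_smul,
        sup_comm (z • _), sup_assoc]
    rw [Finset.coe_insert, Set.image_insert_eq, key, key, Finset.card_insert_of_notMem hy]
    refine (ih _).trans ?_
    rw [pow_succ, mul_assoc]
    gcongr
    have h1 : ∀ z : B, Ideal.span (s : Set B) • (⊤ : Submodule B M) ⊔ (z • (⊤ : Submodule B M) ⊔ Q)
        = z • (⊤ : Submodule B M) ⊔ (Ideal.span (s : Set B) • (⊤ : Submodule B M) ⊔ Q) := by
      intro z
      rw [sup_left_comm]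
    rw [h1, h1]
    exact length_quotient_pow_smul_sup_le _ _ _

variable [IsNoetherianRing B] [IsLocalRing B]

open IsLocalRing

/-- The set `s` lifts a system of parameters of `B/𝔡`. -/
lemma exists_finset_pow_maximalIdeal_le (𝔡 : Ideal B) (h𝔡 : 𝔡 ≠ ⊤) :
    ∃ s : Finset B, (s : Set B) ⊆ maximalIdeal B ∧ (s.card : WithBot ℕ∞) ≤ ringKrullDim (B ⧸ 𝔡) ∧
      ∃ N, maximalIdeal B ^ N ≤ Ideal.span (s : Set B) ⊔ 𝔡 := by
  classical
  have : Nontrivial (B ⧸ 𝔡) := Ideal.Quotient.nontrivial_iff.mpr h𝔡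
  have : IsLocalRing (B ⧸ 𝔡) :=
    IsLocalRing.of_surjective' (Ideal.Quotient.mk 𝔡) Ideal.Quotient.mk_surjective
  obtain ⟨t, ht, hcard⟩ :=
    (maximalIdeal (B ⧸ 𝔡)).exists_finset_card_eq_height_of_isNoetherianRing
  have hsub : (t : Set (B ⧸ 𝔡)) ⊆ maximalIdeal (B ⧸ 𝔡) :=
    Ideal.subset_span.trans ht.1.2
  let σ : B ⧸ 𝔡 → B := Function.surjInv Ideal.Quotient.mk_surjective
  have hσ : ∀ x, Ideal.Quotient.mk 𝔡 (σ x) = x := Function.surjInv_eq _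
  have hmax : (maximalIdeal (B ⧸ 𝔡)).comap (Ideal.Quotient.mk 𝔡) = maximalIdeal B :=
    IsLocalRing.eq_maximalIdeal
      (Ideal.comap_isMaximal_of_surjective _ Ideal.Quotient.mk_surjective)
  refine ⟨t.image σ, ?_, ?_, ?_⟩
  · intro x hx
    obtain ⟨y, hy, rfl⟩ := Finset.mem_image.mp (Finset.mem_coe.mp hx)
    rw [← hmax]
    change Ideal.Quotient.mk 𝔡 (σ y) ∈ maximalIdeal (B ⧸ 𝔡)
    rw [hσ]
    exact hsub hy
  · rw [← maximalIdeal_height_eq_ringKrullDim, ← hcard]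
    have : (t.image σ).card ≤ t.card := Finset.card_image_le
    exact_mod_cast this
  · have hrad : maximalIdeal B ≤ (Ideal.span ((t.image σ : Finset B) : Set B) ⊔ 𝔡).radical := by
      rw [Ideal.radical_eq_sInf]
      refine le_sInf ?_
      rintro P ⟨hP, hPp⟩
      have h𝔡P : 𝔡 ≤ P := le_sup_right.trans hP
      have hPm : (P.map (Ideal.Quotient.mk 𝔡)).IsPrime :=
        Ideal.map_isPrime_of_surjective Ideal.Quotient.mk_surjective (by simpa using h𝔡P)
      have hcm : (P.map (Ideal.Quotient.mk 𝔡)).comap (Ideal.Quotient.mk 𝔡) = P := by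
        rw [Ideal.comap_map_of_surjective' _ Ideal.Quotient.mk_surjective, Ideal.mk_ker]
        exact sup_eq_left.mpr h𝔡P
      rw [← hmax, ← hcm]
      refine Ideal.comap_mono (ht.2 ⟨hPm, ?_⟩ (IsLocalRing.le_maximalIdeal hPm.ne_top))
      rw [Ideal.span_le]
      intro x hx
      rw [← hσ x]
      exact Ideal.mem_map_of_mem _ (hP (Ideal.mem_sup_left (Ideal.subset_span
        (Finset.mem_coe.mpr (Finset.mem_image_of_mem σ hx)))))
    exact Ideal.exists_pow_le_of_le_radical_of_fg hrad (IsNoetherian.noetherian _)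

lemma length_quotient_maximalIdeal_smul_ne_top (M : Type*) [AddCommGroup M] [Module B M]
    [Module.Finite B M] :
    Module.length B (M ⧸ maximalIdeal B • (⊤ : Submodule B M)) ≠ ⊤ := by
  have : Module.length B (M ⧸ maximalIdeal B • (⊤ : Submodule B M)) =
      Module.length (B ⧸ maximalIdeal B) (M ⧸ maximalIdeal B • (⊤ : Submodule B M)) :=
    Module.length_eq_of_surjective Ideal.Quotient.mk_surjective
  rw [this]
  let _ : Field (B ⧸ maximalIdeal B) := Ideal.Quotient.field _
  have : Module.Finite (B ⧸ maximalIdeal B) (M ⧸ maximalIdeal B • (⊤ : Submodule B M)) :=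
    Module.Finite.of_restrictScalars_finite B _ _
  exact Module.length_ne_top

lemma length_quotient_pow_maximalIdeal_smul_ne_top [Module.Finite B M] (N : ℕ) :
    Module.length B (M ⧸ maximalIdeal B ^ N • (⊤ : Submodule B M)) ≠ ⊤ := by
  induction N with
  | zero =>
    have : (maximalIdeal B ^ 0) • (⊤ : Submodule B M) = ⊤ := by simp
    rw [this]
    simp [Module.length_eq_zero]
  | succ N ih =>
    rw [length_quotient_eq_comap_add (maximalIdeal B ^ N • (⊤ : Submodule B M)).subtype _]
    refine WithTop.add_ne_top.mpr ⟨ne_top_of_le_ne_top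
      (length_quotient_maximalIdeal_smul_ne_top ↥(maximalIdeal B ^ N • (⊤ : Submodule B M)))
      (length_quotient_le_of_le ?_), ne_top_of_le_ne_top ih (length_quotient_le_of_le ?_)⟩
    · rw [← Submodule.map_le_iff_le_comap, Submodule.map_smul'', Submodule.map_top,
        Submodule.range_subtype, pow_succ', mul_smul]
    · rw [Submodule.range_subtype]
      exact le_sup_left

lemma length_ne_top_of_pow_maximalIdeal_le [Module.Finite B M] {Q : Submodule B M} {N : ℕ}
    (h : maximalIdeal B ^ N • (⊤ : Submodule B M) ≤ Q) : Module.length B (M ⧸ Q) ≠ ⊤ :=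
  ne_top_of_le_ne_top (length_quotient_pow_maximalIdeal_smul_ne_top N)
    (length_quotient_le_of_le h)

/-- If `M` is killed by `𝔡`, then `λ(M / m^{[q]} M)` grows at most like `q ^ dim (B / 𝔡)`. -/
lemma exists_length_quotient_frobPower_le [Module.Finite B M] (𝔡 : Ideal B)
    (h𝔡 : 𝔡 • (⊤ : Submodule B M) = ⊥) {t : ℕ} (ht : ringKrullDim (B ⧸ 𝔡) ≤ t) :
    ∃ C : ℕ, ∀ q : ℕ, 0 < q →
      Module.length B (M ⧸ frobPower (maximalIdeal B) q • (⊤ : Submodule B M)) ≤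
        (C * q ^ t : ℕ) := by
  by_cases hd : 𝔡 = ⊤
  · refine ⟨0, fun q _ => ?_⟩
    have : Subsingleton M := by
      rw [hd, Submodule.top_smul] at h𝔡
      exact (Submodule.subsingleton_iff B).mp (subsingleton_of_bot_eq_top h𝔡.symm)
    simp [Module.length_eq_zero]
  -- Because `𝔡` kills `M`, the parameters of `B/𝔡` already give `M/(s)M` finite length. Their
  -- `q`-th powers lie in `m^{[q]}`, whence the bound `C q^{|s|}`.
  obtain ⟨s, hs, hcard, N, hN⟩ := exists_finset_pow_maximalIdeal_le 𝔡 hd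
  have hfin : Module.length B (M ⧸ (Ideal.span (s : Set B) • (⊤ : Submodule B M) ⊔ ⊥)) ≠ ⊤ := by
    refine length_ne_top_of_pow_maximalIdeal_le (N := N) ?_
    rw [← h𝔡, ← Submodule.sup_smul]
    exact Submodule.smul_mono hN le_rfl
  obtain ⟨C, hC⟩ := ENat.ne_top_iff_exists.mp hfin
  have hst : s.card ≤ t := by exact_mod_cast hcard.trans ht
  refine ⟨C, fun q hq => ?_⟩
  have h1 := length_quotient_span_pow_le s q (⊥ : Submodule B M)
  rw [← hC] at h1
  refine (length_quotient_le_of_le ?_).trans (h1.trans ?_)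
  · rw [sup_bot_eq]
    refine Submodule.smul_mono (Ideal.span_mono ?_) le_rfl
    exact Set.image_mono hs
  · rw [mul_comm]
    push_cast
    gcongr
    exact_mod_cast hq

end LengthGrowth

section Dimension

/-- A chain of primes over `𝔡` extends downwards by a minimal prime of `𝔢`, strictly because no such
prime contains `𝔡`. This makes cokernels asymptotically negligible. -/
lemma ringKrullDim_quotient_add_one_le {B : Type*} [CommRing B] {𝔢 𝔡 : Ideal B} (hle : 𝔢 ≤ 𝔡)
    (h : ∀ P ∈ 𝔢.minimalPrimes, ¬ 𝔡 ≤ P) :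
    ringKrullDim (B ⧸ 𝔡) + 1 ≤ ringKrullDim (B ⧸ 𝔢) := by
  by_cases hd : 𝔡 = ⊤
  · have : Subsingleton (B ⧸ 𝔡) := Ideal.Quotient.subsingleton_iff.mpr hd
    rw [ringKrullDim_eq_bot_of_subsingleton]
    simp
  have : Nonempty (PrimeSpectrum.zeroLocus (R := B) 𝔡) := by
    rwa [Set.nonempty_coe_sort, Set.nonempty_iff_ne_empty, ne_eq,
      PrimeSpectrum.zeroLocus_empty_iff_eq_top]
  have : Nonempty (PrimeSpectrum.zeroLocus (R := B) 𝔢) := by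
    obtain ⟨x⟩ := this
    exact ⟨⟨x.1, hle.trans x.2⟩⟩
  rw [ringKrullDim_quotient, Order.krullDim_eq_iSup_length, ringKrullDim_quotient,
    Order.krullDim_eq_iSup_length, ← WithBot.coe_one, ← WithBot.coe_add,
    ENat.iSup_add, WithBot.coe_le_coe, iSup_le_iff]
  intro l
  obtain ⟨p, hp, hp'⟩ := Ideal.exists_minimalPrimes_le (I := 𝔢) (J := l.head.1.asIdeal)
    (hle.trans l.head.2)
  let p' : PrimeSpectrum.zeroLocus (R := B) 𝔢 := ⟨⟨p, hp.1.1⟩, hp.1.2⟩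
  let ι : PrimeSpectrum.zeroLocus (R := B) 𝔡 → PrimeSpectrum.zeroLocus (R := B) 𝔢 :=
    fun x => ⟨x.1, hle.trans x.2⟩
  have hlt : p' < (l.map ι fun _ _ hxy => hxy).head := by
    refine lt_of_le_of_ne hp' fun heq => h p hp ?_
    have h1 : p = l.head.1.asIdeal := congrArg (fun x => x.1.asIdeal) heq
    rw [h1]
    exact l.head.2
  refine le_trans ?_ (le_iSup _ ((l.map ι fun _ _ hxy => hxy).cons p' hlt))
  simp only [RelSeries.cons_length, Nat.cast_add, Nat.cast_one]
  exact le_rfl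

end Dimension

/-! ### Normalized lengths and their error terms -/

section RelativeLength

open IsLocalRing

variable {B : Type*} [CommRing B] (p : ℕ) [ExpChar B p]

/-- `λ(M / (I₀^{[q]} M : w ^ q)) / q ^ d` with `q = p ^ k`. -/
noncomputable def normLen (d : ℕ) (I₀ : Ideal B) (w : B) (M : Type*) [AddCommGroup M] [Module B M]
    (k : ℕ) : ℝ :=
  ((colonLen (I₀.map (iterateFrobenius B p k)) (w ^ p ^ k) M).toNat : ℝ) / ((p : ℝ) ^ k) ^ d

variable {p} {I₀ : Ideal B} {w : B} {d : ℕ}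
  {M N : Type*} [AddCommGroup M] [Module B M] [AddCommGroup N] [Module B N]

lemma normLen_nonneg (k : ℕ) : 0 ≤ normLen p d I₀ w M k := by
  unfold normLen
  positivity

variable [IsLocalRing B]

/-- Raising `w * y ∈ I₀` to the `q`-th power settles the generators. This yields finiteness and the
growth bound for all colon lengths in use. -/
lemma mul_frobPower_subset (hw : ∀ x ∈ maximalIdeal B, w * x ∈ I₀) (k : ℕ) :
    ∀ x ∈ frobPower (maximalIdeal B) (p ^ k),
      w ^ p ^ k * x ∈ I₀.map (iterateFrobenius B p k) := by
  intro x hx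
  refine Submodule.span_induction (p := fun x _ => w ^ p ^ k * x ∈ I₀.map (iterateFrobenius B p k))
    ?_ ?_ ?_ ?_ hx
  · rintro _ ⟨y, hy, rfl⟩
    have := Ideal.mem_map_of_mem (iterateFrobenius B p k) (hw y hy)
    rwa [iterateFrobenius_def, mul_pow] at this
  · simp
  · intro a b _ _ ha hb
    rw [mul_add]
    exact add_mem ha hb
  · intro a b _ hb
    rw [smul_eq_mul, mul_left_comm]
    exact Ideal.mul_mem_left _ _ hb

variable [IsNoetherianRing B]

section

variable (hw : ∀ x ∈ maximalIdeal B, w * x ∈ I₀)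
include hw

lemma colonLen_frob_ne_top (hp : 0 < p) [Module.Finite B M] (k : ℕ) :
    colonLen (I₀.map (iterateFrobenius B p k)) (w ^ p ^ k) M ≠ ⊤ := by
  have : FiniteRingKrullDim B := inferInstance
  obtain ⟨t, ht⟩ : ∃ t : ℕ, ringKrullDim (B ⧸ (⊥ : Ideal B)) ≤ t := by
    have h1 : ringKrullDim B < ⊤ := ringKrullDim_lt_top
    have h2 : ringKrullDim B ≠ ⊥ := ringKrullDim_ne_bot
    obtain ⟨n, hn⟩ : ∃ n : ℕ, ringKrullDim B = n := by
      generalize ringKrullDim B = x at *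
      cases x with
      | bot => simp at h2
      | coe x =>
        cases x with
        | top => exact absurd h1 (by simp)
        | coe n => exact ⟨n, rfl⟩
    exact ⟨n, (ringKrullDim_quotient_le _).trans hn.le⟩
  obtain ⟨C, hC⟩ := exists_length_quotient_frobPower_le (M := M) ⊥ (by simp) ht
  exact ne_top_of_le_ne_top (ENat.natCast_ne_top _) ((colonLen_le_length
    (mul_frobPower_subset hw k)).trans (hC _ (pow_pos hp k)))

lemma exists_normLen_le (hp : 0 < p) [Module.Finite B M] (hd : ringKrullDim B ≤ d) :
    ∃ C : ℝ, ∀ k, normLen p d I₀ w M k ≤ C := by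
  obtain ⟨C, hC⟩ := exists_length_quotient_frobPower_le (M := M) ⊥ (by simp)
    ((ringKrullDim_quotient_le _).trans hd)
  refine ⟨C, fun k => ?_⟩
  have h1 := (colonLen_le_length (M := M) (mul_frobPower_subset hw k)).trans (hC _ (pow_pos hp k))
  have h2 := ENat.toNat_le_toNat h1 (ENat.natCast_ne_top _)
  rw [ENat.toNat_natCast] at h2
  unfold normLen
  rw [div_le_iff₀ (by positivity)]
  exact_mod_cast h2

/-- A linear map whose cokernel has small dimension gives an asymptotic inequality. -/
lemma exists_normLen_le_add (hp : 0 < p) [Module.Finite B M] [Module.Finite B N] (𝔡 : Ideal B)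
    (hd : ringKrullDim (B ⧸ 𝔡) + 1 ≤ d) (α : M →ₗ[B] N)
    (hα : 𝔡 • (⊤ : Submodule B N) ≤ LinearMap.range α) :
    ∃ C : ℝ, ∀ k, normLen p d I₀ w N k ≤ normLen p d I₀ w M k + C / (p : ℝ) ^ k := by
  -- If `d = 0`, the dimension of `B ⧸ 𝔡` must be `⊥`, so `𝔡 = ⊤`; then `α` is onto and no error
  -- term arises.
  obtain ⟨t, ht, htd⟩ : ∃ t : ℕ, ringKrullDim (B ⧸ 𝔡) ≤ t ∧ (t + 1 = d ∨ 𝔡 = ⊤) := by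
    rcases d with _ | t
    · refine ⟨0, ?_, Or.inr ?_⟩
      · refine le_trans ?_ hd
        exact le_add_of_nonneg_right zero_le_one
      · by_contra h
        have : Nontrivial (B ⧸ 𝔡) := Ideal.Quotient.nontrivial_iff.mpr h
        have h0 : 0 ≤ ringKrullDim (B ⧸ 𝔡) := ringKrullDim_nonneg_of_nontrivial
        have h2 := (add_le_add_left h0 1).trans hd
        norm_num at h2
    · refine ⟨t, ?_, Or.inl rfl⟩
      push_cast at hd
      exact ENat.WithBot.add_le_add_one_right_iff.mp hd
  have hkill : 𝔡 • (⊤ : Submodule B (N ⧸ LinearMap.range α)) = ⊥ := by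
    have h1 := Submodule.map_smul'' 𝔡 ⊤ (LinearMap.range α).mkQ
    rw [Submodule.map_top, Submodule.range_mkQ] at h1
    rw [← h1, eq_bot_iff, Submodule.map_le_iff_le_comap, Submodule.comap_bot, Submodule.ker_mkQ]
    exact hα
  obtain ⟨C, hC⟩ := exists_length_quotient_frobPower_le (M := N ⧸ LinearMap.range α) 𝔡 hkill ht
  have hlen : ∀ 𝔟 : Ideal B, Module.length B (N ⧸ (LinearMap.range α ⊔ 𝔟 • (⊤ : Submodule B N))) =
      Module.length B ((N ⧸ LinearMap.range α) ⧸
        𝔟 • (⊤ : Submodule B (N ⧸ LinearMap.range α))) := by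
    intro 𝔟
    have h1 : 𝔟 • (⊤ : Submodule B (N ⧸ LinearMap.range α)) =
        (LinearMap.range α ⊔ 𝔟 • (⊤ : Submodule B N)).map (LinearMap.range α).mkQ := by
      rw [Submodule.map_sup, Submodule.map_smul'', Submodule.map_top, Submodule.range_mkQ,
        Submodule.mkQ_map_self, bot_sup_eq]
    rw [h1]
    exact (Submodule.quotientQuotientEquivQuotient _ _ le_sup_left).length_eq.symm
  have main : ∀ k, colonLen (I₀.map (iterateFrobenius B p k)) (w ^ p ^ k) N ≤
      colonLen (I₀.map (iterateFrobenius B p k)) (w ^ p ^ k) M + (C * (p ^ k) ^ t : ℕ) := by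
    intro k
    refine (colonLen_le_add (mul_frobPower_subset hw k) α).trans (add_le_add le_rfl ?_)
    rw [hlen]
    exact hC _ (pow_pos hp k)
  have hppos : (0 : ℝ) < p := by exact_mod_cast hp
  rcases htd with rfl | htop
  · refine ⟨C, fun k => ?_⟩
    have h2 := ENat.toNat_le_toNat (main k)
      (WithTop.add_ne_top.mpr ⟨colonLen_frob_ne_top hw hp k, ENat.natCast_ne_top _⟩)
    rw [ENat.toNat_add (colonLen_frob_ne_top hw hp k) (ENat.natCast_ne_top _),
      ENat.toNat_natCast] at h2
    unfold normLen
    have h3 : (C : ℝ) / (p : ℝ) ^ k = (C * ((p : ℝ) ^ k) ^ t) / ((p : ℝ) ^ k) ^ (t + 1) := by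
      field_simp
      ring
    rw [h3, ← add_div]
    gcongr
    exact_mod_cast h2
  · refine ⟨0, fun k => ?_⟩
    have hr : LinearMap.range α = ⊤ := by
      rw [htop, Submodule.top_smul] at hα
      exact top_le_iff.mp hα
    have h1 := colonLen_le_add (mul_frobPower_subset (p := p) hw k) α
    have h0 : Module.length B (N ⧸ (LinearMap.range α ⊔
        frobPower (maximalIdeal B) (p ^ k) • (⊤ : Submodule B N))) = 0 := by
      rw [hr, top_sup_eq]
      exact Module.length_eq_zero
    rw [h0, add_zero] at h1
    have h2 := ENat.toNat_le_toNat h1 (colonLen_frob_ne_top (M := M) (I₀ := I₀) hw hp k)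
    unfold normLen
    rw [zero_div, add_zero]
    gcongr

lemma normLen_pi (hp : 0 < p) {ι : Type*} [Fintype ι] (M : ι → Type*)
    [∀ i, AddCommGroup (M i)] [∀ i, Module B (M i)] [∀ i, Module.Finite B (M i)] (k : ℕ) :
    normLen p d I₀ w (∀ i, M i) k = ∑ i, normLen p d I₀ w (M i) k := by
  unfold normLen
  rw [colonLen_pi, ENat.toNat_sum fun i _ => colonLen_frob_ne_top hw hp k, ← Finset.sum_div]
  push_cast
  rfl

end

end RelativeLength

/-! ### Convergence of approximately geometric sequences -/

section Recursion

/-- All `s ≥ 0` are allowed, so the rank of the Frobenius pushforward need not be computed. For `s =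
1` the sequence is Cauchy, for `s < 1` it contracts to `0`, and for `s > 1` boundedness forces it to
`0`. -/
lemma tendsto_of_abs_sub_mul_le {u : ℕ → ℝ} {s C D a : ℝ} (h0 : ∀ k, 0 ≤ u k) (hD : ∀ k, u k ≤ D)
    (hs : 0 ≤ s) (ha0 : 0 ≤ a) (ha1 : a < 1) (h : ∀ k, |u (k + 1) - s * u k| ≤ C * a ^ k) :
    ∃ e : ℝ, Tendsto u atTop (𝓝 e) := by
  have hbdd : ∀ L : ℝ, (∀ᶠ k in atTop, u k ≤ L) → 0 ≤ L := fun L hL => by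
    obtain ⟨k, hk⟩ := hL.exists
    exact (h0 k).trans hk
  have ha : Tendsto (fun k : ℕ => C * a ^ k) atTop (𝓝 0) := by
    simpa using (tendsto_pow_atTop_nhds_zero_of_lt_one ha0 ha1).const_mul C
  rcases lt_trichotomy s 1 with hs1 | rfl | hs1
  · refine ⟨0, ?_⟩
    have hcob : IsBoundedUnder (· ≤ ·) atTop u := isBoundedUnder_of ⟨D, hD⟩
    have hcob' : IsBoundedUnder (· ≥ ·) atTop u := isBoundedUnder_of ⟨0, h0⟩
    have key : limsup u atTop ≤ 0 := by
      by_contra hneg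
      push Not at hneg
      set l := limsup u atTop with hl
      -- With `ε = (1 - s) l / 4` one has `s (l + ε) + ε ≤ l - ε`, which contradicts `l` being the
      -- limsup.
      have hlt : l < l + (1 - s) * l / 4 := by nlinarith
      have e1 : ∀ᶠ k in atTop, u k < l + (1 - s) * l / 4 := eventually_lt_of_limsup_lt hlt hcob
      have e2 : ∀ᶠ k in atTop, C * a ^ k < (1 - s) * l / 4 :=
        (tendsto_order.1 ha).2 _ (by nlinarith)
      have e3 : ∀ᶠ k in atTop, u (k + 1) ≤ l - (1 - s) * l / 4 := by
        filter_upwards [e1, e2] with k hk1 hk2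
        have := (abs_le.mp (h k)).2
        have h5 : s * u k ≤ s * (l + (1 - s) * l / 4) := by gcongr
        have h6 : 0 < (1 - s) * l := by nlinarith
        nlinarith
      have e4 : ∀ᶠ k in atTop, u k ≤ l - (1 - s) * l / 4 :=
        (by
          obtain ⟨K, hK⟩ := eventually_atTop.mp e3
          refine eventually_atTop.mpr ⟨K + 1, fun k hk => ?_⟩
          obtain ⟨j, rfl⟩ := Nat.exists_eq_add_of_lt hk
          exact hK (K + j) (by omega))
      have := limsup_le_of_le (f := atTop) (u := u) (hcob'.isCoboundedUnder_le) e4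
      nlinarith
    exact tendsto_of_le_liminf_of_limsup_le
      (le_liminf_of_le (hcob.isCoboundedUnder_ge) (Eventually.of_forall h0)) key hcob hcob'
  · have : CauchySeq u := cauchySeq_of_le_geometric a C ha1 fun k => by
      rw [dist_comm, Real.dist_eq]
      simpa using h k
    exact cauchySeq_tendsto_of_complete this
  · refine ⟨0, ?_⟩
    have hC0 : 0 ≤ C := by simpa using (abs_nonneg _).trans (h 0)
    -- `u k ≤ s⁻¹ ^ j * u (k + j) + C * a ^ k / (s - 1)`
    have step : ∀ k j, u k ≤ (s⁻¹) ^ j * u (k + j) + C * a ^ k / (s - 1) * (1 - (s⁻¹) ^ j) := by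
      intro k j
      induction j with
      | zero => simp
      | succ j ih =>
        have h1 := (abs_le.mp (h (k + j))).1
        have h2 : C * a ^ (k + j) ≤ C * a ^ k := by
          gcongr 1
          exact pow_le_pow_of_le_one ha0 ha1.le (by omega)
        have h3 : u (k + j) ≤ s⁻¹ * (u (k + j + 1) + C * a ^ k) := by
          rw [inv_mul_eq_div, le_div_iff₀ (by linarith)]
          linarith
        have h4 : (s⁻¹) ^ j * u (k + j) ≤ (s⁻¹) ^ j * (s⁻¹ * (u (k + j + 1) + C * a ^ k)) := by
          gcongr
        refine ih.trans ((add_le_add h4 le_rfl).trans (le_of_eq ?_))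
        have : s - 1 ≠ 0 := by linarith
        have : s ≠ 0 := by linarith
        rw [pow_succ, ← add_assoc k j 1]
        field_simp
        ring
    have bound : ∀ k, u k ≤ C * a ^ k / (s - 1) := by
      intro k
      have hlim : Tendsto (fun j : ℕ => (s⁻¹) ^ j * D + C * a ^ k / (s - 1) * (1 - (s⁻¹) ^ j)) atTop
          (𝓝 (0 * D + C * a ^ k / (s - 1) * (1 - 0))) := by
        have h1 : Tendsto (fun j : ℕ => (s⁻¹) ^ j) atTop (𝓝 0) :=
          tendsto_pow_atTop_nhds_zero_of_lt_one (by positivity) (inv_lt_one_of_one_lt₀ hs1)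
        exact (h1.mul_const D).add ((tendsto_const_nhds.sub h1).const_mul _)
      have := ge_of_tendsto' hlim fun j => (step k j).trans (by gcongr; exact hD _)
      simpa using this
    refine squeeze_zero h0 bound ?_
    simpa using ha.div_const (s - 1)

end Recursion

/-! ### Structure of finite modules up to smaller dimension -/

section GenericRank

variable {D : Type*} [CommRing D] [IsDomain D] {N : Type*} [AddCommGroup N] [Module D N]
  [Module.Finite D N]

lemma exists_smul_mem_span_of_finrank_le {r : ℕ} (hr : Module.finrank D N ≤ r) {b : Fin r → N}
    (hb : LinearIndependent D b) (x : N) : ∃ c : D, c ≠ 0 ∧ c • x ∈ Submodule.span D (Set.range b) := by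
  by_contra! h
  have hli : LinearIndependent D (Fin.cons x b : Fin (r + 1) → N) := by
    refine hb.finCons' x b fun c y hyb hy => ?_
    by_contra hc
    refine h c hc ?_
    rw [eq_neg_of_add_eq_zero_left hy]
    exact neg_mem hyb
  have := hli.fintype_card_le_finrank
  rw [Fintype.card_fin] at this
  omega

/-- A finite module of rank `r` over a domain is a free module of rank `r` up to torsion, by maps
in both directions. -/
lemma exists_linearMap_pi_finrank :
    ∃ (α : (Fin (Module.finrank D N) → D) →ₗ[D] N) (β : N →ₗ[D] (Fin (Module.finrank D N) → D))
      (c : D), c ≠ 0 ∧ (∀ x, c • x ∈ LinearMap.range α) ∧ ∀ x, c • x ∈ LinearMap.range β := by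
  classical
  obtain ⟨b, hb⟩ := exists_linearIndependent_of_le_finrank (le_refl (Module.finrank D N))
  have hαinj : LinearMap.ker (Fintype.linearCombination D b) = ⊥ :=
    LinearMap.ker_eq_bot.mpr (hb.fintypeLinearCombination_injective)
  obtain ⟨s, hs⟩ := Module.Finite.fg_top (R := D) (M := N)
  choose f hf0 hf using fun x : N => exists_smul_mem_span_of_finrank_le le_rfl hb x
  have hrange : ∀ x : N, (∏ y ∈ s, f y) • x ∈ LinearMap.range (Fintype.linearCombination D b) := by
    intro x
    have hx : x ∈ Submodule.span D (s : Set N) := by rw [hs]; trivial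
    rw [Fintype.range_linearCombination]
    induction hx using Submodule.span_induction with
    | mem y hy =>
      rw [← Finset.mul_prod_erase s f (Finset.mem_coe.mp hy), mul_comm, mul_smul]
      exact Submodule.smul_mem _ _ (hf y)
    | zero => simp
    | add y z _ _ hy hz => rw [smul_add]; exact add_mem hy hz
    | smul a y _ hy => rw [smul_comm]; exact Submodule.smul_mem _ _ hy
  -- Multiplication by the common denominator lands in the range of the injective map `α`. Following
  -- it by `α⁻¹` gives `β`, and `β ∘ α` is multiplication by that same element.
  let e := LinearEquiv.ofInjective (Fintype.linearCombination D b) (LinearMap.ker_eq_bot.mp hαinj)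
  refine ⟨Fintype.linearCombination D b, e.symm.toLinearMap ∘ₗ
    (LinearMap.lsmul D N (∏ y ∈ s, f y)).codRestrict _ hrange, ∏ y ∈ s, f y,
    Finset.prod_ne_zero_iff.mpr fun y _ => hf0 y, hrange, fun x => ?_⟩
  refine ⟨Fintype.linearCombination D b x, ?_⟩
  rw [LinearMap.comp_apply, LinearEquiv.coe_coe, LinearEquiv.symm_apply_eq]
  ext
  rw [map_smul]
  rfl

end GenericRank

section MinimalPrimeDecomposition

open Submodule

variable {B : Type*} [CommRing B] [IsNoetherianRing B] {M : Type*} [AddCommGroup M] [Module B M]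

/-- A module killed by the nilradical is, up to modules of smaller support, the product of its
reductions modulo the minimal primes. -/
lemma exists_linearMap_pi_minimalPrimes (hM : nilradical B • (⊤ : Submodule B M) = ⊥) :
    ∃ (α : M →ₗ[B] (∀ P : minimalPrimes B, M ⧸ (P.1 • (⊤ : Submodule B M))))
      (β : (∀ P : minimalPrimes B, M ⧸ (P.1 • (⊤ : Submodule B M))) →ₗ[B] M)
      (c : B), (∀ P ∈ minimalPrimes B, c ∉ P) ∧ (∀ x, c • x ∈ LinearMap.range α) ∧
        ∀ x, c • x ∈ LinearMap.range β := by
  classical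
  have hfin : Finite (minimalPrimes B) := (minimalPrimes.finite_of_isNoetherianRing B)
  cases nonempty_fintype (minimalPrimes B)
  -- The intersection of the other minimal primes is not contained in `P`. Then `c P` multiplies `P`
  -- into the nilradical, so it induces `M/PM → M`, and the sum of all `c P` avoids every minimal
  -- prime.
  have hex : ∀ P : minimalPrimes B, ∃ c : B, c ∉ P.1 ∧ ∀ Q : minimalPrimes B, Q ≠ P → c ∈ Q.1 := by
    intro P
    by_contra! h
    have hP : P.1.IsPrime := P.2.1.1
    have hle : (Finset.univ.erase P).inf (fun Q : minimalPrimes B => Q.1) ≤ P.1 := by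
      intro c hc
      by_contra hcP
      obtain ⟨Q, hQP, hcQ⟩ := h c hcP
      exact hcQ ((Finset.inf_le (f := fun Q : minimalPrimes B => Q.1)
        (Finset.mem_erase.mpr ⟨hQP, Finset.mem_univ Q⟩)) hc)
    obtain ⟨Q, hQ, hQP⟩ := hP.inf_le'.mp hle
    refine (Finset.mem_erase.mp hQ).1 (Subtype.ext ?_)
    exact le_antisymm hQP (P.2.2 ⟨Q.2.1.1, bot_le⟩ hQP)
  choose c hcP hcQ using hex
  have hkill : ∀ (P : minimalPrimes B), ∀ x ∈ P.1 • (⊤ : Submodule B M), c P • x = 0 := by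
    intro P x hx
    have hmem : ∀ a ∈ P.1, c P * a ∈ nilradical B := by
      intro a ha
      rw [nilradical_eq_sInf]
      rw [Ideal.mem_sInf]
      intro Q hQ
      have : Q.IsPrime := hQ
      obtain ⟨Q', hQ', hle⟩ := Ideal.exists_minimalPrimes_le (I := (⊥ : Ideal B)) (J := Q) bot_le
      apply hle
      by_cases h : (⟨Q', hQ'⟩ : minimalPrimes B) = P
      · subst h
        exact Ideal.mul_mem_left _ _ ha
      · exact Ideal.mul_mem_right _ _ (hcQ P _ h)
    refine Submodule.smul_induction_on hx (fun a ha y _ => ?_) fun y z hy hz => ?_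
    · rw [smul_smul]
      have : (c P * a) • y ∈ nilradical B • (⊤ : Submodule B M) :=
        Submodule.smul_mem_smul (hmem a ha) trivial
      rwa [hM] at this
    · rw [smul_add, hy, hz, add_zero]
  let α : M →ₗ[B] (∀ P : minimalPrimes B, M ⧸ (P.1 • (⊤ : Submodule B M))) :=
    LinearMap.pi fun P => Submodule.mkQ _
  let γ : ∀ P : minimalPrimes B, (M ⧸ (P.1 • (⊤ : Submodule B M))) →ₗ[B] M := fun P =>
    Submodule.liftQ _ (LinearMap.lsmul B M (c P)) fun x hx => hkill P x hx
  let β : (∀ P : minimalPrimes B, M ⧸ (P.1 • (⊤ : Submodule B M))) →ₗ[B] M :=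
    ∑ P, γ P ∘ₗ LinearMap.proj P
  have hβ : ∀ m : ∀ P : minimalPrimes B, M, β (fun P => Submodule.Quotient.mk (m P)) =
      ∑ P, c P • m P := by
    intro m
    simp only [β, LinearMap.sum_apply, LinearMap.comp_apply, LinearMap.proj_apply]
    rfl
  refine ⟨α, β, ∑ P, c P, ?_, ?_, ?_⟩
  · intro P hP hc
    refine hcP ⟨P, hP⟩ ?_
    rw [← Finset.add_sum_erase _ _ (Finset.mem_univ (⟨P, hP⟩ : minimalPrimes B))] at hc
    refine (Submodule.add_mem_iff_left P ?_).mp hc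
    exact Submodule.sum_mem _ fun Q hQ => hcQ Q ⟨P, hP⟩ (Finset.mem_erase.mp hQ).1.symm
  · intro x
    obtain ⟨m, rfl⟩ : ∃ m : ∀ P : minimalPrimes B, M, x = fun P => Submodule.Quotient.mk (m P) :=
      ⟨fun P => (Submodule.Quotient.mk_surjective _ (x P)).choose,
        funext fun P => ((Submodule.Quotient.mk_surjective _ (x P)).choose_spec).symm⟩
    refine ⟨∑ Q, c Q • m Q, ?_⟩
    funext P
    change Submodule.Quotient.mk (∑ Q, c Q • m Q) = Submodule.Quotient.mk ((∑ Q, c Q) • m P)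
    rw [ Submodule.Quotient.eq, Finset.sum_smul,
      ← Finset.sum_sub_distrib]
    refine Submodule.sum_mem _ fun Q _ => ?_
    rw [← smul_sub]
    by_cases h : P = Q
    · subst h
      simp
    · exact Submodule.smul_mem_smul (hcQ Q P h) trivial
  · intro x
    refine ⟨α x, ?_⟩
    rw [Finset.sum_smul]
    exact hβ fun _ => x

end MinimalPrimeDecomposition

/-! ### Frobenius pushforwards and their finiteness -/

section FrobeniusCopy

open IsLocalRing

/-- A copy of the ring `D`, to be regarded as an algebra through the `e`-th iterate of the
Frobenius endomorphism of `D`. -/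
def FrobCopy (_p _e : ℕ) (D : Type*) : Type _ := D

variable {p e : ℕ} {B D : Type*} [CommRing B] [CommRing D] [ExpChar D p]

instance : CommRing (FrobCopy p e D) := inferInstanceAs (CommRing D)

instance [IsNoetherianRing D] : IsNoetherianRing (FrobCopy p e D) :=
  inferInstanceAs (IsNoetherianRing D)

instance [IsLocalRing D] : IsLocalRing (FrobCopy p e D) := inferInstanceAs (IsLocalRing D)

instance [Algebra B D] : Algebra B (FrobCopy p e D) :=
  RingHom.toAlgebra (S := FrobCopy p e D) ((iterateFrobenius D p e).comp (algebraMap B D))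

instance [Algebra B D] : IsScalarTower B D (FrobCopy p e D) :=
  IsScalarTower.of_algebraMap_eq fun _ => rfl

variable [Algebra B D]

lemma isLocalHom_frobCopy (h : IsLocalHom (algebraMap B D)) :
    IsLocalHom (algebraMap B (FrobCopy p e D)) where
  map_nonunit a ha := by
    have ha' : IsUnit (algebraMap B D a ^ p ^ e) := ha
    exact h.map_nonunit a (isUnit_of_pow_eq_unit ha')
where isUnit_of_pow_eq_unit {x : D} (h : IsUnit (x ^ p ^ e)) : IsUnit x :=
  (isUnit_pow_iff (pow_ne_zero e (expChar_pos D p).ne')).mp h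

variable [IsLocalRing B] [IsLocalRing D] [ExpChar B p]

/-- On the copy, `b : B` acts as its `p^e`-th power, so level `k` becomes level `k + e`. By `hres`
and `hperf` both `B`-algebra structures have trivial residue extension, so lengths over `B` and over
`D` agree. -/
lemma colonLen_frobCopy (hloc : IsLocalHom (algebraMap B D))
    (hres : ∀ x : D, ∃ b : B, x - algebraMap B D b ∈ maximalIdeal D)
    (hperf : ∀ x : D, ∃ b : B, x - algebraMap B D b ^ p ^ e ∈ maximalIdeal D)
    (I₀ : Ideal B) (w : B) (k : ℕ) :
    colonLen (I₀.map (iterateFrobenius B p k)) (w ^ p ^ k) (FrobCopy p e D) =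
      colonLen (I₀.map (iterateFrobenius B p (k + e))) (w ^ p ^ (k + e)) D := by
  rw [colonLen_map (D := FrobCopy p e D) (isLocalHom_frobCopy hloc) hperf,
    colonLen_map (D := D) hloc hres]
  have h1 : (I₀.map (iterateFrobenius B p k)).map (algebraMap B (FrobCopy p e D)) =
      (I₀.map (iterateFrobenius B p (k + e))).map (algebraMap B D) := by
    rw [Ideal.map_map, Ideal.map_map]
    congr 1
    ext x
    change (algebraMap B D (x ^ p ^ k)) ^ p ^ e = algebraMap B D (x ^ p ^ (k + e))
    rw [map_pow, map_pow, ← pow_mul, pow_add]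
  have h2 : algebraMap B (FrobCopy p e D) (w ^ p ^ k) = algebraMap B D (w ^ p ^ (k + e)) := by
    change (algebraMap B D (w ^ p ^ k)) ^ p ^ e = algebraMap B D (w ^ p ^ (k + e))
    rw [map_pow, map_pow, ← pow_mul, pow_add]
  rw [h1, h2]
  rfl

lemma normLen_frobCopy (hloc : IsLocalHom (algebraMap B D))
    (hres : ∀ x : D, ∃ b : B, x - algebraMap B D b ∈ maximalIdeal D)
    (hperf : ∀ x : D, ∃ b : B, x - algebraMap B D b ^ p ^ e ∈ maximalIdeal D)
    (d : ℕ) (I₀ : Ideal B) (w : B) (k : ℕ) :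
    normLen p d I₀ w (FrobCopy p e D) k = normLen p d I₀ w D (k + e) * ((p : ℝ) ^ e) ^ d := by
  unfold normLen
  have : (p : ℝ) ≠ 0 := by exact_mod_cast (expChar_pos D p).ne'
  rw [colonLen_frobCopy hloc hres hperf, pow_add (p : ℝ) k e, mul_pow]
  field_simp

end FrobeniusCopy

section FiniteFrobenius

open IsLocalRing

lemma isPrecomplete_pi {B : Type*} [CommRing B] (I : Ideal B) [IsPrecomplete I B] {ι : Type*}
    [Finite ι] : IsPrecomplete I (ι → B) where
  prec' f hf := by
    have hmem : ∀ n (x : ι → B), x ∈ I ^ n • (⊤ : Submodule B (ι → B)) ↔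
        ∀ i, x i ∈ I ^ n • (⊤ : Submodule B B) := by
      intro n x
      rw [ideal_smul_top_pi (I ^ n) fun _ : ι => B]
      simp
    have h : ∀ i, ∃ L : B, ∀ n, f n i ≡ L [SMOD (I ^ n • ⊤ : Submodule B B)] := fun i =>
      IsPrecomplete.prec' (fun n => f n i) fun {m n} hmn => by
        have := hf hmn
        rw [SModEq.sub_mem, hmem] at this
        rw [SModEq.sub_mem]
        exact this i
    choose L hL using h
    refine ⟨L, fun n => ?_⟩
    rw [SModEq.sub_mem, hmem]
    intro i
    have := hL i n
    rwa [SModEq.sub_mem] at this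

/-- Over a complete ring, a separated module is finite if it is so modulo the ideal. -/
lemma finite_of_finite_quotient {B : Type*} [CommRing B] (I : Ideal B) [IsPrecomplete I B]
    {M : Type*} [AddCommGroup M] [Module B M] [IsHausdorff I M]
    [Module.Finite B (M ⧸ I • (⊤ : Submodule B M))] : Module.Finite B M := by
  obtain ⟨n, f, hf⟩ := Module.Finite.exists_fin (R := B) (M := M ⧸ I • (⊤ : Submodule B M))
  choose g hg using fun i => Submodule.Quotient.mk_surjective _ (f i)
  have := isPrecomplete_pi I (ι := Fin n)
  have hsurj : Function.Surjective
      (Submodule.mkQ (I • (⊤ : Submodule B M)) ∘ₗ Fintype.linearCombination B g) := by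
    rw [← LinearMap.range_eq_top, LinearMap.range_comp, Fintype.range_linearCombination,
      Submodule.map_span, ← Set.range_comp, ← hf]
    congr 2
    ext i
    exact hg i
  exact Module.Finite.of_surjective _ (surjective_of_mkQ_comp_surjective hsurj)

variable {p e : ℕ} {B D : Type*} [CommRing B] [CommRing D] [ExpChar D p] [Algebra B D]
  [IsLocalRing B] [IsLocalRing D] [ExpChar B p] [IsNoetherianRing B] [Module.Finite B D]
  [IsPrecomplete (maximalIdeal B) B]

/-- Modulo `m` the pushforward has the length of `D/m^{[p^e]}D`, which is finite. Completeness of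
`B` and Krull's intersection theorem lift finiteness from this quotient. -/
lemma finite_frobCopy (hloc : IsLocalHom (algebraMap B D))
    (hres : ∀ x : D, ∃ b : B, x - algebraMap B D b ∈ maximalIdeal D)
    (hperf : ∀ x : D, ∃ b : B, x - algebraMap B D b ^ p ^ e ∈ maximalIdeal D) :
    Module.Finite B (FrobCopy p e D) := by
  have hN : IsNoetherianRing D := IsNoetherianRing.of_finite B D
  have hloc' : IsLocalHom (algebraMap B (FrobCopy p e D)) := isLocalHom_frobCopy hloc
  have hH : IsHausdorff (maximalIdeal B) (FrobCopy p e D) := by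
    refine IsHausdorff.of_map (J := maximalIdeal (FrobCopy p e D)) ?_
    rw [Ideal.map_le_iff_le_comap]
    exact ((local_hom_TFAE _).out 0 4).mp hloc' ▸ le_rfl
  -- The exponent `0 + e` matches `colonLen_frobCopy` at `k = 0`.
  have hfin := colonLen_frob_ne_top (p := p) (I₀ := maximalIdeal B) (w := 1) (M := D)
    (fun x hx => by simpa using hx) (expChar_pos B p) (0 + e)
  rw [← colonLen_frobCopy hloc hres hperf, colonLen, Module.length_ne_top_iff,
    isFiniteLength_iff_isNoetherian_isArtinian] at hfin
  have hsub : colonSub ((maximalIdeal B).map (iterateFrobenius B p 0)) (1 ^ p ^ 0)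
      (FrobCopy p e D) = maximalIdeal B • (⊤ : Submodule B (FrobCopy p e D)) := by
    ext x
    rw [mem_colonSub, one_pow, one_smul, iterateFrobenius_zero, Ideal.map_id]
  rw [hsub] at hfin
  have := hfin.1
  exact finite_of_finite_quotient (maximalIdeal B)

end FiniteFrobenius

/-! ### Limits over a complete local ring -/

section Convergence

open IsLocalRing

variable {p : ℕ}

lemma tendsto_of_abs_sub_le_div (hp : 1 < p) {u v : ℕ → ℝ} {C e : ℝ}
    (h : ∀ k, |u k - v k| ≤ C / (p : ℝ) ^ k) (hv : Tendsto v atTop (𝓝 e)) :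
    Tendsto u atTop (𝓝 e) := by
  have hp' : (1 : ℝ) < p := by exact_mod_cast hp
  have h0 : Tendsto (fun k : ℕ => C / (p : ℝ) ^ k) atTop (𝓝 0) :=
    tendsto_const_nhds.div_atTop (tendsto_pow_atTop_atTop_of_one_lt hp')
  have h1 : Tendsto (fun k => u k - v k) atTop (𝓝 0) := squeeze_zero_norm h h0
  simpa using h1.add hv

variable {B : Type*} [CommRing B] [ExpChar B p] [IsLocalRing B] [IsNoetherianRing B]
  {I₀ : Ideal B} {w : B} {d : ℕ}

lemma exists_sub_pow_mem {A : Type*} [CommRing A] [IsLocalRing A]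
    (hperf : ∀ x : A, ∃ y : A, x - y ^ p ∈ maximalIdeal A) (e : ℕ) (x : A) : ∃ y : A, x - y ^ p ^ e ∈ maximalIdeal A := by
  induction e with
  | zero => exact ⟨x, by simp⟩
  | succ e ih =>
    obtain ⟨y, hy⟩ := ih
    obtain ⟨z, hz⟩ := hperf y
    refine ⟨z, ?_⟩
    have h1 : y ^ p ^ e - (z ^ p) ^ p ^ e ∈ maximalIdeal A :=
      Ideal.mem_of_dvd _ (sub_dvd_pow_sub_pow y (z ^ p) (p ^ e)) hz
    have := add_mem hy h1
    rwa [sub_add_sub_cancel, ← pow_mul, mul_comm p, ← pow_succ] at this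

lemma span_smul_top_le_range {A X Y : Type*} [CommRing A] [AddCommGroup X] [AddCommGroup Y]
    [Module A X] [Module A Y] (γ : X →ₗ[A] Y) {c : A} (hγ : ∀ y, c • y ∈ LinearMap.range γ) :
    Ideal.span {c} • (⊤ : Submodule A Y) ≤ LinearMap.range γ := by
  rw [Submodule.smul_le]
  intro r hr y _
  obtain ⟨a, rfl⟩ := Ideal.mem_span_singleton'.mp hr
  rw [mul_smul]
  exact Submodule.smul_mem _ _ (hγ y)

lemma ker_sup_span_smul_top_le_range {A D X Y : Type*} [CommRing A] [CommRing D] [Algebra A D]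
    [AddCommGroup X] [AddCommGroup Y] [Module A X] [Module A Y] [Module D X] [Module D Y]
    [IsScalarTower A D X] [IsScalarTower A D Y] (γ : X →ₗ[D] Y) {b : A}
    (hγ : ∀ y, algebraMap A D b • y ∈ LinearMap.range γ) :
    (RingHom.ker (algebraMap A D) ⊔ Ideal.span {b}) • (⊤ : Submodule A Y) ≤
      LinearMap.range (γ.restrictScalars A) := by
  rw [Submodule.sup_smul, sup_le_iff]
  refine ⟨?_, span_smul_top_le_range _ fun y => ?_⟩
  · rw [Submodule.smul_le]
    intro r hr y _
    rw [← algebraMap_smul D r y, (RingHom.mem_ker).mp hr, zero_smul]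
    exact zero_mem _
  · rw [← algebraMap_smul D b y]
    exact hγ y

section

variable (hw : ∀ x ∈ maximalIdeal B, w * x ∈ I₀) (hp : 0 < p)
include hw hp

/-- Two modules with maps in both directions whose cokernels have small dimension. -/
lemma exists_abs_normLen_sub_le {M N : Type*} [AddCommGroup M] [Module B M] [AddCommGroup N]
    [Module B N] [Module.Finite B M] [Module.Finite B N] (𝔡 : Ideal B)
    (hd : ringKrullDim (B ⧸ 𝔡) + 1 ≤ d) (α : M →ₗ[B] N)
    (hα : 𝔡 • (⊤ : Submodule B N) ≤ LinearMap.range α) (β : N →ₗ[B] M)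
    (hβ : 𝔡 • (⊤ : Submodule B M) ≤ LinearMap.range β) :
    ∃ C : ℝ, ∀ k, |normLen p d I₀ w N k - normLen p d I₀ w M k| ≤ C / (p : ℝ) ^ k := by
  obtain ⟨C₁, h₁⟩ := exists_normLen_le_add hw hp 𝔡 hd α hα
  obtain ⟨C₂, h₂⟩ := exists_normLen_le_add hw hp 𝔡 hd β hβ
  refine ⟨max C₁ C₂, fun k => ?_⟩
  have hpk : (0 : ℝ) < (p : ℝ) ^ k := pow_pos (by exact_mod_cast hp) k
  have e₁ : C₁ / (p : ℝ) ^ k ≤ max C₁ C₂ / (p : ℝ) ^ k := by gcongr; exact le_max_left _ _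
  have e₂ : C₂ / (p : ℝ) ^ k ≤ max C₁ C₂ / (p : ℝ) ^ k := by gcongr; exact le_max_right _ _
  rw [abs_le]
  constructor <;> linarith [h₁ k, h₂ k]

variable (hd : ringKrullDim B ≤ d)
include hd

/-- `N` and the free `D`-module of the same rank map to each other with cokernels killed by `P +
(b)`, where `D = B/P` and `b ∉ P`; this ideal has a quotient of dimension below `d`. -/
lemma exists_abs_normLen_sub_finrank_mul_le {D N : Type*} [CommRing D] [IsDomain D] [Algebra B D]
    (hD : Function.Surjective (algebraMap B D)) [AddCommGroup N] [Module B N] [Module D N]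
    [IsScalarTower B D N] [Module.Finite B N] :
    ∃ C : ℝ, ∀ k, |normLen p d I₀ w N k - Module.finrank D N * normLen p d I₀ w D k| ≤
      C / (p : ℝ) ^ k := by
  have : Module.Finite B D := Module.Finite.of_surjective (Algebra.linearMap B D) hD
  have : Module.Finite D N := Module.Finite.of_restrictScalars_finite B D N
  obtain ⟨α, β, c, hc, hα, hβ⟩ := exists_linearMap_pi_finrank (D := D) (N := N)
  obtain ⟨b, rfl⟩ := hD c
  set P := RingHom.ker (algebraMap B D)
  have hP : P.IsPrime := RingHom.ker_isPrime _
  have hdim : ringKrullDim (B ⧸ (P ⊔ Ideal.span {b})) + 1 ≤ d := by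
    refine (ringKrullDim_quotient_add_one_le (𝔢 := P) le_sup_left fun Q hQ hle => ?_).trans
      ((ringKrullDim_quotient_le _).trans hd)
    have hQP : Q = P := by
      rw [Ideal.minimalPrimes_eq_subsingleton_self] at hQ
      exact hQ
    rw [hQP] at hle
    exact hc (hle (Ideal.mem_sup_right (Ideal.mem_span_singleton_self b)))
  obtain ⟨C, hC⟩ := exists_abs_normLen_sub_le hw hp _ hdim (α.restrictScalars B) 
    (ker_sup_span_smul_top_le_range α hα) (β.restrictScalars B)
    (ker_sup_span_smul_top_le_range β hβ)
  refine ⟨C, fun k => ?_⟩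
  have := hC k
  rw [normLen_pi hw hp fun _ : Fin (Module.finrank D N) => D] at this
  simpa using this

end

variable [Fact p.Prime] [CharP B p] [IsPrecomplete (maximalIdeal B) B]

section

variable (hw : ∀ x ∈ maximalIdeal B, w * x ∈ I₀) (hd : ringKrullDim B ≤ d)
  (hperf : ∀ x : B, ∃ y : B, x - y ^ p ∈ maximalIdeal B)
include hw hd hperf

/-- If the Frobenius pushforward of `B/P` has rank `r`, the normalized lengths `u` satisfy `p^d
u(k+1) = r u(k) + O(p^{-k})`. They are bounded, so they converge whatever `r` is. -/
lemma exists_tendsto_normLen_quotient_prime (P : Ideal B) [hP : P.IsPrime] :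
    ∃ e : ℝ, Tendsto (normLen p d I₀ w (B ⧸ P)) atTop (𝓝 e) := by
  have hp1 : 1 < p := (Fact.out : p.Prime).one_lt
  have hp0 : 0 < p := hp1.le
  have hchar : CharP (B ⧸ P) p := by
    rw [CharP.charP_iff_prime_eq_zero Fact.out, ← map_natCast (algebraMap B (B ⧸ P)),
      CharP.cast_eq_zero, map_zero]
  have hloc : IsLocalRing (B ⧸ P) :=
    IsLocalRing.of_surjective' (Ideal.Quotient.mk P) Ideal.Quotient.mk_surjective
  have hlocal : IsLocalHom (algebraMap B (B ⧸ P)) :=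
    IsLocalHom.of_surjective _ Ideal.Quotient.mk_surjective
  have hmax' : (maximalIdeal B).map (algebraMap B (B ⧸ P)) ≤ maximalIdeal (B ⧸ P) :=
    ((local_hom_TFAE _).out 0 2).mp hlocal
  have hmax : ∀ x ∈ maximalIdeal B, algebraMap B (B ⧸ P) x ∈ maximalIdeal (B ⧸ P) :=
    fun x hx => hmax' (Ideal.mem_map_of_mem _ hx)
  have hres : ∀ x : B ⧸ P, ∃ b : B, x - algebraMap B (B ⧸ P) b ∈ maximalIdeal (B ⧸ P) := by
    intro x
    obtain ⟨b, rfl⟩ := Ideal.Quotient.mk_surjective x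
    exact ⟨b, by simp⟩
  have hperf' : ∀ x : B ⧸ P, ∃ b : B,
      x - algebraMap B (B ⧸ P) b ^ p ^ 1 ∈ maximalIdeal (B ⧸ P) := by
    intro x
    obtain ⟨b, rfl⟩ := Ideal.Quotient.mk_surjective x
    obtain ⟨y, hy⟩ := hperf b
    refine ⟨y, ?_⟩
    have := hmax _ hy
    rwa [map_sub, map_pow, ← pow_one p] at this
  have hfin : Module.Finite B (FrobCopy p 1 (B ⧸ P)) := finite_frobCopy hlocal hres hperf'
  obtain ⟨C, hC⟩ := exists_abs_normLen_sub_finrank_mul_le (N := FrobCopy p 1 (B ⧸ P)) hw hp0 hd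
    (D := B ⧸ P) Ideal.Quotient.mk_surjective
  obtain ⟨K, hK⟩ := exists_normLen_le (M := B ⧸ P) hw hp0 hd
  have hpd : (0 : ℝ) < (p : ℝ) ^ d := pow_pos (by exact_mod_cast hp0) d
  refine tendsto_of_abs_sub_mul_le (s := Module.finrank (B ⧸ P) (FrobCopy p 1 (B ⧸ P)) / (p : ℝ) ^ d)
    (C := C / (p : ℝ) ^ d) (a := (p : ℝ)⁻¹) (fun k => normLen_nonneg k) hK (by positivity)
    (by positivity) (inv_lt_one_of_one_lt₀ (by exact_mod_cast hp1)) fun k => ?_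
  have h1 := hC k
  rw [normLen_frobCopy hlocal hres hperf', pow_one] at h1
  set r : ℝ := (Module.finrank (B ⧸ P) (FrobCopy p 1 (B ⧸ P)) : ℝ)
  have h2 : normLen p d I₀ w (B ⧸ P) (k + 1) - r / (p : ℝ) ^ d * normLen p d I₀ w (B ⧸ P) k =
      (normLen p d I₀ w (B ⧸ P) (k + 1) * (p : ℝ) ^ d - r * normLen p d I₀ w (B ⧸ P) k) /
        (p : ℝ) ^ d := by
    field_simp
  rw [h2, abs_div, abs_of_pos hpd, inv_pow, div_mul_eq_mul_div, ← div_eq_mul_inv]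
  gcongr

lemma exists_tendsto_normLen_of_nilradical_smul {M : Type*} [AddCommGroup M] [Module B M]
    [Module.Finite B M] (hM : nilradical B • (⊤ : Submodule B M) = ⊥) :
    ∃ e : ℝ, Tendsto (normLen p d I₀ w M) atTop (𝓝 e) := by
  have hp1 : 1 < p := (Fact.out : p.Prime).one_lt
  have hp0 : 0 < p := hp1.le
  have : Finite (minimalPrimes B) := minimalPrimes.finite_of_isNoetherianRing B
  cases nonempty_fintype (minimalPrimes B)
  obtain ⟨α, β, c, hc, hα, hβ⟩ := exists_linearMap_pi_minimalPrimes hM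
  have hdim : ringKrullDim (B ⧸ Ideal.span {c}) + 1 ≤ d := by
    refine (ringKrullDim_quotient_add_one_le (𝔢 := ⊥) bot_le fun Q hQ hle => ?_).trans
      ((ringKrullDim_quotient_le _).trans hd)
    exact hc Q hQ (hle (Ideal.mem_span_singleton_self c))
  obtain ⟨C, hC⟩ := exists_abs_normLen_sub_le hw hp0 _ hdim β
    (span_smul_top_le_range β hβ) α (span_smul_top_le_range α hα)
  have hconv : ∀ P : minimalPrimes B, ∃ e : ℝ,
      Tendsto (normLen p d I₀ w (M ⧸ (P.1 • (⊤ : Submodule B M)))) atTop (𝓝 e) := by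
    intro P
    have hP : P.1.IsPrime := P.2.1.1
    obtain ⟨e, he⟩ := exists_tendsto_normLen_quotient_prime hw hd hperf P.1
    obtain ⟨C, hC⟩ := exists_abs_normLen_sub_finrank_mul_le
      (N := M ⧸ (P.1 • (⊤ : Submodule B M))) hw hp0 hd (D := B ⧸ P.1) Ideal.Quotient.mk_surjective
    exact ⟨_, tendsto_of_abs_sub_le_div hp1 hC (he.const_mul _)⟩
  choose e he using hconv
  refine ⟨∑ P, e P, tendsto_of_abs_sub_le_div hp1 hC ?_⟩
  have h1 : normLen p d I₀ w (∀ P : minimalPrimes B, M ⧸ (P.1 • (⊤ : Submodule B M))) =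
      fun k => ∑ P : minimalPrimes B, normLen p d I₀ w (M ⧸ (P.1 • (⊤ : Submodule B M))) k :=
    funext fun k => normLen_pi hw hp0 _ k
  rw [h1]
  exact tendsto_finsetSum _ fun P _ => he P

/-- Existence of the limit over a complete local ring with perfect residue field. -/
theorem exists_tendsto_normLen_of_isPrecomplete :
    ∃ e : ℝ, Tendsto (normLen p d I₀ w B) atTop (𝓝 e) := by
  have hp1 : 1 < p := (Fact.out : p.Prime).one_lt
  have hp0 : 0 < p := hp1.le
  obtain ⟨n, hn⟩ := IsNoetherianRing.isNilpotent_nilradical B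
  have hlocal : IsLocalHom (algebraMap B B) := inferInstance
  have hres : ∀ x : B, ∃ b : B, x - algebraMap B B b ∈ maximalIdeal B := fun x => ⟨x, by simp⟩
  have hperf' := exists_sub_pow_mem hperf n
  have hfin : Module.Finite B (FrobCopy p n B) := finite_frobCopy hlocal hres hperf'
  -- Here `n` is an exponent killing the nilradical. As `n ≤ p^n`, nilpotent elements act by zero on
  -- the `n`-th pushforward, whose lengths are those of `B` shifted by `n`.
  have hnil : nilradical B • (⊤ : Submodule B (FrobCopy p n B)) = ⊥ := by
    rw [eq_bot_iff, Submodule.smul_le]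
    intro b hb x _
    have h1 : b ^ n = 0 := by
      have := Ideal.pow_mem_pow hb n
      rwa [hn] at this
    have h2 : algebraMap B (FrobCopy p n B) b = 0 := by
      change b ^ p ^ n = 0
      exact pow_eq_zero_of_le (Nat.lt_pow_self hp1).le h1
    rw [Submodule.mem_bot, Algebra.smul_def, h2, zero_mul]
  obtain ⟨e, he⟩ := exists_tendsto_normLen_of_nilradical_smul hw hd hperf hnil
  have h3 : (fun k => normLen p d I₀ w B (k + n)) =
      fun k => normLen p d I₀ w (FrobCopy p n B) k / ((p : ℝ) ^ n) ^ d := by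
    funext k
    rw [normLen_frobCopy hlocal hres hperf', mul_div_cancel_right₀]
    have : (0 : ℝ) < p := by exact_mod_cast hp0
    positivity
  refine ⟨e / ((p : ℝ) ^ n) ^ d, (tendsto_add_atTop_iff_nat n).mp ?_⟩
  rw [h3]
  exact he.div_const _

end

end Convergence

/-! ### Passage to the completion -/

section CompletionNoetherian

/-- The completion of a Noetherian ring is Noetherian, being a quotient of a power series ring. -/
theorem isNoetherianRing_adicCompletion {R : Type*} [CommRing R] [IsNoetherianRing R]
    (I : Ideal R) : IsNoetherianRing (AdicCompletion I R) := by
  obtain ⟨n, g, hg⟩ := Submodule.fg_iff_exists_fin_generating_family.mp (IsNoetherian.noetherian I)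
  let P := MvPolynomial (Fin n) R
  let J : Ideal P := MvPolynomial.idealOfVars (Fin n) R
  let φ : P →ₐ[R] R := MvPolynomial.aeval g
  have hJ : J.map (φ : P →+* R) = I := by
    change (Ideal.span (Set.range MvPolynomial.X)).map (φ : P →+* R) = I
    rw [← hg, Ideal.map_span, ← Set.range_comp]
    congr 2
    ext i
    exact MvPolynomial.aeval_X g i
  have hJk : ∀ k, J ^ k ≤ (I ^ k).comap (φ : P →+* R) := fun k => by
    rw [← Ideal.map_le_iff_le_comap, Ideal.map_pow, hJ]
  let f : (k : ℕ) → AdicCompletion J P →+* R ⧸ I ^ k := fun k =>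
    (Ideal.quotientMap (I ^ k) (φ : P →+* R) (hJk k)).comp
      (AdicCompletion.evalₐ J k : AdicCompletion J P →+* P ⧸ J ^ k)
  have hf : ∀ {m k : ℕ} (hle : m ≤ k), (Ideal.Quotient.factorPow I hle).comp (f k) = f m := by
    intro m k hle
    ext x
    induction x using AdicCompletion.induction_on with
    | _ x =>
    simp only [f, RingHom.comp_apply, RingHom.coe_coe, AdicCompletion.evalₐ_mk,
      Ideal.quotientMap_mk]
    exact congrArg (Ideal.quotientMap (I ^ m) (φ : P →+* R) (hJk m))
      (AdicCompletion.Ideal.mk_eq_mk J hle x)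
  let F : AdicCompletion J P →+* AdicCompletion I R := AdicCompletion.liftRingHom I f hf
  have hF : ∀ x : P, F (algebraMap P (AdicCompletion J P) x) =
      algebraMap R (AdicCompletion I R) (φ x) := by
    intro x
    refine AdicCompletion.ext_evalₐ fun k => ?_
    rw [AdicCompletion.evalₐ_liftRingHom]
    simp [f, AdicCompletion.algebraMap_apply]
  have hmap : (J.map (algebraMap P (AdicCompletion J P))).map F =
      I.map (algebraMap R (AdicCompletion I R)) := by
    have : ∀ K : Ideal R, J.map (φ : P →+* R) = K →
        J.map (F.comp (algebraMap P (AdicCompletion J P))) =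
          K.map (algebraMap R (AdicCompletion I R)) := by
      rintro _ rfl
      rw [Ideal.map_map]
      congr 1
    rw [Ideal.map_map]
    exact this I hJ
  have hIc := AdicCompletion.isAdicComplete_self I (IsNoetherian.noetherian I)
  have hJc := AdicCompletion.isAdicComplete_self J (MvPolynomial.idealOfVars_fg (Fin n) R)
  have hH : IsHausdorff ((J.map (algebraMap P (AdicCompletion J P))).map F)
      (AdicCompletion I R) := by
    rw [hmap]
    infer_instance
  -- As the source is complete and the target separated, surjectivity may be tested modulo `I`,
  -- where constants suffice.
  have hsurj : Function.Surjective F := by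
    refine surjective_of_mk_map_comp_surjective F (I := J.map (algebraMap P (AdicCompletion J P))) ?_
    intro y
    obtain ⟨y, rfl⟩ := Ideal.Quotient.mk_surjective y
    obtain ⟨r, hr⟩ := Ideal.Quotient.mk_surjective (AdicCompletion.evalOneₐ I y)
    refine ⟨algebraMap P _ (MvPolynomial.C r), ?_⟩
    rw [RingHom.comp_apply, hF, Ideal.Quotient.eq, hmap,
      ← AdicCompletion.ker_evalOneₐ_eq_map I (IsNoetherian.noetherian I), RingHom.mem_ker]
    rw [map_sub, sub_eq_zero]
    have : φ (MvPolynomial.C r) = r := MvPolynomial.aeval_C g r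
    rw [this]
    exact hr
  have : IsNoetherianRing (AdicCompletion J P) :=
    isNoetherianRing_of_ringEquiv (MvPowerSeries (Fin n) R)
      (MvPowerSeries.toAdicCompletionAlgEquiv (Fin n) R).toRingEquiv
  exact isNoetherianRing_of_surjective _ _ F hsurj

end CompletionNoetherian

section LocalDimension

open IsLocalRing

/-- The maximal ideal of `C` is minimal over the images of parameters of `A`, so Krull's height
theorem applies. It serves both the completion and `S`. -/
lemma ringKrullDim_le_of_maximalIdeal_le_radical {A C : Type*} [CommRing A] [CommRing C]
    [IsLocalRing A] [IsLocalRing C] [IsNoetherianRing A] [IsNoetherianRing C] [Algebra A C]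
    (hloc : (maximalIdeal A).map (algebraMap A C) ≤ maximalIdeal C)
    (h : maximalIdeal C ≤ ((maximalIdeal A).map (algebraMap A C)).radical) :
    ringKrullDim C ≤ ringKrullDim A := by
  classical
  obtain ⟨s, hs, hcard, N, hN⟩ := exists_finset_pow_maximalIdeal_le (⊥ : Ideal A) bot_ne_top
  refine le_trans ?_ (hcard.trans (ringKrullDim_quotient_le _))
  rw [sup_bot_eq] at hN
  have hspan : Ideal.span ((s.image (algebraMap A C) : Finset C) : Set C) =
      (Ideal.span (s : Set A)).map (algebraMap A C) := by
    rw [Ideal.map_span, Finset.coe_image]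
  have hmin : maximalIdeal C ∈
      (Ideal.span ((s.image (algebraMap A C) : Finset C) : Set C)).minimalPrimes := by
    rw [hspan]
    refine ⟨⟨inferInstance, (Ideal.map_mono (Ideal.span_le.mpr hs)).trans hloc⟩, ?_⟩
    rintro Q ⟨hQ, hle⟩ -
    refine h.trans ((hQ.radical_le_iff).mpr ?_)
    have h1 : ((maximalIdeal A).map (algebraMap A C)) ^ N ≤ Q := by
      rw [← Ideal.map_pow]
      exact (Ideal.map_mono hN).trans hle
    exact hQ.le_of_pow_le h1
  rw [← maximalIdeal_height_eq_ringKrullDim]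
  have h1 := Ideal.height_le_card_of_mem_minimalPrimes_span_finset hmin
  have h2 : ((s.image (algebraMap A C)).card : ℕ∞) ≤ s.card := by
    exact_mod_cast Finset.card_image_le
  exact_mod_cast h1.trans h2

end LocalDimension

section FlatTransfer

open IsLocalRing TensorProduct

variable {A C : Type*} [CommRing A] [CommRing C] [Algebra A C] [Module.Flat A C]

/-- Tensor the exact sequence `0 → (𝔞 : c) → A → A/𝔞`, whose last map is multiplication by `c`, with
the flat algebra `C`. -/
lemma colonSub_map_of_flat (𝔞 : Ideal A) (c : A) :
    colonSub (𝔞.map (algebraMap A C)) (algebraMap A C c) C =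
      Ideal.map (algebraMap A C) (colonSub 𝔞 c A : Ideal A) := by
  apply le_antisymm
  · intro y hy
    have hy' : algebraMap A C c * y ∈ 𝔞.map (algebraMap A C) := mem_colonSub_self.mp hy
    let f : A →ₗ[A] A ⧸ 𝔞 := 𝔞.mkQ ∘ₗ LinearMap.lsmul A A c
    have hex : Function.Exact (colonSub 𝔞 c A).subtype f := by
      rw [LinearMap.exact_iff, Submodule.range_subtype]
      ext x
      rw [LinearMap.mem_ker, mem_colonSub_self]
      exact Submodule.Quotient.mk_eq_zero _
    have hz : ∀ z ∈ 𝔞.map (algebraMap A C), z ⊗ₜ[A] (Submodule.Quotient.mk 1 : A ⧸ 𝔞) = 0 := by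
      intro z hz
      refine Submodule.span_induction
        (p := fun z _ => z ⊗ₜ[A] (Submodule.Quotient.mk 1 : A ⧸ 𝔞) = 0) ?_ ?_ ?_ ?_ hz
      · rintro _ ⟨a, ha, rfl⟩
        rw [Algebra.algebraMap_eq_smul_one, TensorProduct.smul_tmul, ← Submodule.Quotient.mk_smul,
          (Submodule.Quotient.mk_eq_zero _).mpr, TensorProduct.tmul_zero]
        simpa using ha
      · simp
      · intro x y _ _ hx hy
        rw [TensorProduct.add_tmul, hx, hy, add_zero]
      · intro b x _ hx
        have := congrArg (fun t => b • t) hx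
        simpa [TensorProduct.smul_tmul'] using this
    have h0 : LinearMap.lTensor C f (y ⊗ₜ[A] (1 : A)) = 0 := by
      rw [LinearMap.lTensor_tmul]
      have h1 : f 1 = c • (Submodule.Quotient.mk 1 : A ⧸ 𝔞) := rfl
      rw [h1, ← TensorProduct.smul_tmul, Algebra.smul_def]
      exact hz _ hy'
    obtain ⟨t, ht⟩ := (Module.Flat.lTensor_exact C hex _).mp h0
    have hmem : ∀ t : C ⊗[A] (colonSub 𝔞 c A),
        TensorProduct.rid A C (LinearMap.lTensor C (colonSub 𝔞 c A).subtype t) ∈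
          Ideal.map (algebraMap A C) (colonSub 𝔞 c A : Ideal A) := by
      intro t
      induction t with
      | zero => simp
      | add x y hx hy => rw [map_add, map_add]; exact add_mem hx hy
      | tmul b x =>
        rw [LinearMap.lTensor_tmul, TensorProduct.rid_tmul, Algebra.smul_def]
        exact Ideal.mul_mem_right _ _ (Ideal.mem_map_of_mem _ x.2)
    have := hmem t
    rw [ht] at this
    simpa using this
  · rw [Ideal.map_le_iff_le_comap]
    intro x hx
    change algebraMap A C x ∈ colonSub (𝔞.map (algebraMap A C)) (algebraMap A C c) C
    rw [mem_colonSub_self, ← map_mul]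
    exact Ideal.mem_map_of_mem _ (mem_colonSub_self.mp hx)

lemma colonLen_map_of_flat [IsLocalRing A] [IsLocalRing C] [IsLocalHom (algebraMap A C)]
    (hmax : (maximalIdeal A).map (algebraMap A C) = maximalIdeal C) (𝔞 : Ideal A) (c : A) :
    colonLen (𝔞.map (algebraMap A C)) (algebraMap A C c) C = colonLen 𝔞 c A := by
  unfold colonLen
  rw [colonSub_map_of_flat]
  have h1 := IsLocalRing.length_baseChange A C (A ⧸ (colonSub 𝔞 c A : Ideal A))
  have h2 : Module.length C (C ⧸ maximalIdeal C) = 1 := by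
    rw [Module.length_eq_one_iff]
    exact isSimpleModule_iff_quot_maximal.mpr ⟨_, inferInstance, ⟨LinearEquiv.refl _ _⟩⟩
  rw [hmax, h2, mul_one] at h1
  rw [← h1]
  exact (Algebra.TensorProduct.quotIdealMapEquivTensorQuot C
    (colonSub 𝔞 c A : Ideal A)).toLinearEquiv.length_eq

end FlatTransfer

section Existence

open IsLocalRing

variable {R : Type*} [CommRing R] [IsLocalRing R] [IsNoetherianRing R]

lemma ringKrullDim_eq_natKrullDim : ringKrullDim R = natKrullDim R := by
  have h1 : ringKrullDim R < ⊤ := ringKrullDim_lt_top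
  have h2 : ringKrullDim R ≠ ⊥ := ringKrullDim_ne_bot
  unfold natKrullDim
  generalize ringKrullDim R = x at *
  cases x with
  | bot => simp at h2
  | coe x =>
    cases x with
    | top => exact absurd h1 (by simp)
    | coe n => rfl

variable {p : ℕ} [Fact p.Prime] [CharP R p]

/-- Existence of the limit over a Noetherian local ring with perfect residue field. -/
theorem exists_tendsto_normLen (hperf : ∀ x : R, ∃ y : R, x - y ^ p ∈ maximalIdeal R)
    {I₀ : Ideal R} {w : R} (hw : ∀ x ∈ maximalIdeal R, w * x ∈ I₀) :
    ∃ e : ℝ, Tendsto (normLen p (natKrullDim R) I₀ w R) atTop (𝓝 e) := by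
  let B := AdicCompletion (maximalIdeal R) R
  have hN : IsNoetherianRing B := isNoetherianRing_adicCompletion _
  have hmax : (maximalIdeal R).map (algebraMap R B) = maximalIdeal B :=
    AdicCompletion.maximalIdeal_eq_map.symm
  have hchar : CharP B p := by
    rw [CharP.charP_iff_prime_eq_zero Fact.out, ← map_natCast (algebraMap R B),
      CharP.cast_eq_zero, map_zero]
  -- Only this upper bound is needed, since the normalizing exponent is `dim R`.
  have hdim : ringKrullDim B ≤ natKrullDim R := by
    rw [← ringKrullDim_eq_natKrullDim]
    exact ringKrullDim_le_of_maximalIdeal_le_radical hmax.le (hmax.symm.le.trans Ideal.le_radical)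
  have hperfB : ∀ x : B, ∃ y : B, x - y ^ p ∈ maximalIdeal B := by
    intro x
    obtain ⟨r, hr⟩ := (AdicCompletion.residueField_map_bijective R).2 (residue B x)
    obtain ⟨r, rfl⟩ := residue_surjective r
    obtain ⟨y, hy⟩ := hperf r
    refine ⟨algebraMap R B y, ?_⟩
    rw [ResidueField.map_residue] at hr
    have h1 : x - algebraMap R B r ∈ maximalIdeal B := by
      rw [← residue_eq_zero_iff, map_sub, hr, sub_self]
    have h2 : algebraMap R B (r - y ^ p) ∈ maximalIdeal B := by
      rw [← hmax]
      exact Ideal.mem_map_of_mem _ hy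
    rw [map_sub, map_pow] at h2
    have := add_mem h1 h2
    rwa [sub_add_sub_cancel] at this
  have hwB : ∀ x ∈ maximalIdeal B, algebraMap R B w * x ∈ I₀.map (algebraMap R B) := by
    intro x hx
    rw [← hmax] at hx
    refine Submodule.span_induction
      (p := fun x _ => algebraMap R B w * x ∈ I₀.map (algebraMap R B)) ?_ ?_ ?_ ?_ hx
    · rintro _ ⟨a, ha, rfl⟩
      rw [← map_mul]
      exact Ideal.mem_map_of_mem _ (hw a ha)
    · simp
    · intro a b _ _ ha hb
      rw [mul_add]
      exact add_mem ha hb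
    · intro a b _ hb
      rw [smul_eq_mul, mul_left_comm]
      exact Ideal.mul_mem_left _ _ hb
  obtain ⟨e, he⟩ := exists_tendsto_normLen_of_isPrecomplete hwB hdim hperfB
  refine ⟨e, he.congr fun k => ?_⟩
  unfold normLen
  have h1 : (I₀.map (algebraMap R B)).map (iterateFrobenius B p k) =
      (I₀.map (iterateFrobenius R p k)).map (algebraMap R B) := by
    rw [Ideal.map_map, Ideal.map_map]
    congr 1
  rw [h1, ← map_pow, colonLen_map_of_flat hmax]

end Existence

/-! ### The length inequality for a radical extension -/

section RadicalLength

variable {S : Type*} [CommRing S] {𝔦 𝔧 : Ideal S} {x ρ : S}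

/-- The colength comparison behind the estimate for radical extensions. -/
theorem colonLen_radical_le {n : ℕ} (h𝔦 : ∀ y ∈ 𝔦, x * ρ * y ∈ 𝔧) (hx : x ^ (2 * n) * ρ ∈ 𝔧) :
    ((n - 1 : ℕ) : ℕ∞) * colonLen 𝔧 (x ^ n * ρ) S +
        n * Module.length S (S ⧸ (Ideal.span {x} ⊔ 𝔦)) ≤
      n * Module.length S (S ⧸ (Ideal.span {x ^ n} ⊔ 𝔦)) := by
  -- By `hL` and `hH` below, `g` and `h` are the successive differences of `L` and `H`. They are
  -- stated additively because lengths may be infinite.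
  let g : ℕ → ℕ∞ := fun i => Module.length S (S ⧸ (Ideal.span {x} ⊔ colonSub 𝔧 (x ^ i * ρ) S))
  let h : ℕ → ℕ∞ := fun i => Module.length S (S ⧸ (Ideal.span {x} ⊔ colonSub 𝔦 (x ^ i) S))
  let L : ℕ → ℕ∞ := fun i => colonLen 𝔧 (x ^ i * ρ) S
  let H : ℕ → ℕ∞ := fun i => Module.length S (S ⧸ (Ideal.span {x ^ i} ⊔ 𝔦))
  have hrange : ∀ c : S, LinearMap.range (LinearMap.lsmul S S c) = Ideal.span {c} := by
    intro c
    ext y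
    simp only [LinearMap.mem_range, LinearMap.lsmul_apply, smul_eq_mul]
    rw [Ideal.mem_span_singleton']
    exact exists_congr fun a => by rw [mul_comm]
  have hL : ∀ i, L i = L (i + 1) + g i := by
    intro i
    have h1 := length_quotient_eq_comap_add (LinearMap.lsmul S S x) (colonSub 𝔧 (x ^ i * ρ) S)
    have h2 : (colonSub 𝔧 (x ^ i * ρ) S).comap (LinearMap.lsmul S S x) =
        colonSub 𝔧 (x ^ (i + 1) * ρ) S := by
      ext y
      rw [Submodule.mem_comap, LinearMap.lsmul_apply, smul_eq_mul, mem_colonSub_self,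
        mem_colonSub_self]
      ring_nf
    rw [h2, hrange] at h1
    exact h1
  have hH : ∀ i, H (i + 1) = H i + h i := by
    intro i
    have h1 := length_quotient_eq_comap_add (LinearMap.lsmul S S (x ^ i))
      (Ideal.span {x ^ (i + 1)} ⊔ 𝔦)
    have h2 : Submodule.comap (LinearMap.lsmul S S (x ^ i)) (Ideal.span {x ^ (i + 1)} ⊔ 𝔦) =
        Ideal.span {x} ⊔ colonSub 𝔦 (x ^ i) S := by
      ext y
      rw [Submodule.mem_comap, LinearMap.lsmul_apply, smul_eq_mul, Submodule.mem_sup,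
        Submodule.mem_sup]
      constructor
      · rintro ⟨a, ha, b, hb, hab⟩
        obtain ⟨c, rfl⟩ := Ideal.mem_span_singleton'.mp ha
        refine ⟨c * x, Ideal.mul_mem_left _ _ (Ideal.mem_span_singleton_self x), y - c * x, ?_,
          by ring⟩
        rw [mem_colonSub_self]
        convert hb using 1
        linear_combination -hab
      · rintro ⟨a, ha, b, hb, rfl⟩
        obtain ⟨c, rfl⟩ := Ideal.mem_span_singleton'.mp ha
        exact ⟨c * x ^ (i + 1), Ideal.mul_mem_left _ _ (Ideal.mem_span_singleton_self _),
          x ^ i * b, mem_colonSub_self.mp hb, by ring⟩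
    have h3 : Ideal.span {x ^ i} ⊔ (Ideal.span {x ^ (i + 1)} ⊔ 𝔦) = Ideal.span {x ^ i} ⊔ 𝔦 := by
      rw [← sup_assoc]
      congr 1
      exact sup_eq_left.mpr (Ideal.span_singleton_le_span_singleton.mpr (pow_dvd_pow x i.le_succ))
    rw [h2, hrange, h3] at h1
    exact h1.trans (add_comm _ _)
  -- From `xρ𝔦 ⊆ 𝔧` one gets `(𝔦 : x^i) ⊆ (𝔧 : x^{i+1} ρ)`.
  have hgh : ∀ i, g (i + 1) ≤ h i := fun i =>
    length_quotient_le_of_le (sup_le_sup_left (fun y hy => by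
      rw [mem_colonSub_self] at hy ⊢
      convert h𝔦 _ hy using 1
      ring) _)
  have hganti : Antitone g := antitone_nat_of_succ_le fun i =>
    length_quotient_le_of_le (sup_le_sup_left (fun y hy => by
      rw [mem_colonSub_self] at hy ⊢
      convert Ideal.mul_mem_left _ x hy using 1
      ring) _)
  have hhanti : Antitone h := antitone_nat_of_succ_le fun i =>
    length_quotient_le_of_le (sup_le_sup_left (fun y hy => by
      rw [mem_colonSub_self] at hy ⊢
      convert Ideal.mul_mem_left _ x hy using 1
      ring) _)
  have hLtop : L (n + n) = 0 := by
    refine Module.length_eq_zero_iff.mpr (Submodule.Quotient.subsingleton_iff.mpr ?_)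
    rw [Ideal.eq_top_iff_one, mem_colonSub_self, mul_one, ← two_mul]
    exact hx
  have hLn : ∀ j : ℕ, L n ≤ j * g n + L (n + j) := by
    intro j
    induction j with
    | zero => simp
    | succ j ih =>
      refine ih.trans ?_
      rw [hL (n + j), Nat.cast_add, Nat.cast_one, add_mul, one_mul, add_assoc (_ * _),
        add_comm (L _) (g _), ← add_assoc, ← add_assoc]
      exact add_le_add_left (add_le_add_right (hganti (Nat.le_add_right n j)) _) _
  have hH1 : ∀ j : ℕ, j ≤ n - 1 → H 1 + j * h (n - 1) ≤ H (1 + j) := by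
    intro j
    induction j with
    | zero => simp
    | succ j ih =>
      intro hj
      rw [← add_assoc 1 j 1, hH (1 + j), Nat.cast_add, Nat.cast_one, add_mul, one_mul, ← add_assoc]
      exact add_le_add (ih (by omega)) (hhanti (show 1 + j ≤ n - 1 by omega))
  rcases Nat.eq_zero_or_pos n with rfl | hn
  · simp
  -- Since `L (2n) = 0`, `L n` is the sum of the `n` drops `g n, …, g (2n-1)`, each at most `g n ≤ h
  -- (n-1)`.
  have h1 : L n ≤ n * h (n - 1) := by
    have := hLn n
    rw [hLtop, add_zero] at this
    refine this.trans (mul_le_mul_right ?_ _)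
    have := hgh (n - 1)
    rwa [Nat.sub_add_cancel hn] at this
  have h2 := hH1 (n - 1) le_rfl
  rw [Nat.add_sub_cancel' hn] at h2
  have h3 : Module.length S (S ⧸ (Ideal.span {x} ⊔ 𝔦)) = H 1 := by
    change _ = Module.length S (S ⧸ (Ideal.span {x ^ 1} ⊔ 𝔦))
    rw [pow_one]
  rw [h3]
  calc ((n - 1 : ℕ) : ℕ∞) * L n + n * H 1
      ≤ ((n - 1 : ℕ) : ℕ∞) * (n * h (n - 1)) + n * H 1 :=
        add_le_add_left (mul_le_mul_right h1 _) _
    _ = n * (H 1 + (n - 1 : ℕ) * h (n - 1)) := by ring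
    _ ≤ n * H n := mul_le_mul_right h2 _

end RadicalLength

/-! ### Hilbert-Kunz multiplicities as limits of colon lengths -/

section ColonLengthIdeal

open IsLocalRing

variable {R : Type*} [CommRing R]

lemma idealQuotLength_span_singleton_sup (𝔞 : Ideal R) (c : R) :
    idealQuotLength 𝔞 (Ideal.span {c} ⊔ 𝔞) = colonLen 𝔞 c R := by
  set J := Ideal.span {c} ⊔ 𝔞
  have hc : ∀ x, LinearMap.lsmul R R c x ∈ J := fun x =>
    Ideal.mem_sup_left (Ideal.mul_mem_right _ _ (Ideal.mem_span_singleton_self c))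
  let f : R →ₗ[R] ↥J ⧸ Submodule.submoduleOf 𝔞 J :=
    (Submodule.submoduleOf 𝔞 J).mkQ ∘ₗ (LinearMap.lsmul R R c).codRestrict J hc
  have hker : LinearMap.ker f = colonSub 𝔞 c R := by
    ext x
    rw [mem_colonSub_self, LinearMap.mem_ker]
    exact Submodule.Quotient.mk_eq_zero _
  have hsurj : Function.Surjective f := by
    intro y
    obtain ⟨⟨y, hy⟩, rfl⟩ := Submodule.Quotient.mk_surjective _ y
    obtain ⟨a, ha, b, hb, rfl⟩ := Submodule.mem_sup.mp hy
    obtain ⟨x, rfl⟩ := Ideal.mem_span_singleton'.mp ha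
    refine ⟨x, (Submodule.Quotient.eq _).mpr ?_⟩
    change c * x - (x * c + b) ∈ 𝔞
    convert neg_mem hb using 1
    ring
  unfold idealQuotLength colonLen
  rw [← hker]
  exact (f.quotKerEquivOfSurjective hsurj).length_eq.symm

lemma colonLen_one (𝔞 : Ideal R) : colonLen 𝔞 1 R = Module.length R (R ⧸ 𝔞) := by
  have : colonSub 𝔞 1 R = 𝔞 := by
    ext x
    rw [mem_colonSub_self, one_mul]
  unfold colonLen
  rw [this]

/-- Length one makes the colon ideal maximal, hence equal to `m`. -/
lemma mul_mem_of_colonLen_eq_one [IsLocalRing R] {𝔞 : Ideal R} {c : R}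
    (h : colonLen 𝔞 c R = 1) : ∀ x ∈ maximalIdeal R, c * x ∈ 𝔞 := by
  have h1 : IsSimpleModule R (R ⧸ colonSub 𝔞 c R) := Module.length_eq_one_iff.mp h
  have h2 : Ideal.IsMaximal (colonSub 𝔞 c R) := ⟨isSimpleModule_iff_isCoatom.mp h1⟩
  intro x hx
  rw [← eq_maximalIdeal h2] at hx
  exact mem_colonSub_self.mp hx

variable {p : ℕ} [ExpChar R p] (I₀ : Ideal R) (w : R)

lemma idealQuotLength_frobPower (k : ℕ) :
    idealQuotLength (frobPower I₀ (p ^ k)) (frobPower (Ideal.span {w} ⊔ I₀) (p ^ k)) =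
      colonLen (I₀.map (iterateFrobenius R p k)) (w ^ p ^ k) R := by
  rw [frobPower_eq_map, frobPower_eq_map, Ideal.map_sup, Ideal.map_span, Set.image_singleton,
    iterateFrobenius_def, idealQuotLength_span_singleton_sup]

lemma length_quotient_frobPower (I : Ideal R) (k : ℕ) :
    Module.length R (R ⧸ frobPower I (p ^ k)) =
      colonLen (I.map (iterateFrobenius R p k)) (1 ^ p ^ k) R := by
  rw [one_pow, colonLen_one, frobPower_eq_map]

variable [IsLocalRing R] [IsNoetherianRing R]

lemma isRelHilbertKunzMultiplicity_of_tendsto (hp : 0 < p) {I₀ : Ideal R} {w : R}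
    (hw : ∀ x ∈ maximalIdeal R, w * x ∈ I₀) {e : ℝ}
    (he : Tendsto (normLen p (natKrullDim R) I₀ w R) atTop (𝓝 e)) :
    IsRelHilbertKunzMultiplicity p I₀ (Ideal.span {w} ⊔ I₀) e := by
  unfold IsRelHilbertKunzMultiplicity
  simp only [idealQuotLength_frobPower]
  exact ⟨colonLen_frob_ne_top hw hp, he⟩

lemma isHilbertKunzMultiplicity_of_tendsto (hp : 0 < p) {e : ℝ}
    (he : Tendsto (normLen p (natKrullDim R) (maximalIdeal R) 1 R) atTop (𝓝 e)) :
    IsHilbertKunzMultiplicity p R e := by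
  unfold IsHilbertKunzMultiplicity
  simp only [length_quotient_frobPower]
  exact ⟨colonLen_frob_ne_top (fun x hx => by rwa [one_mul]) hp, he⟩

end ColonLengthIdeal

/-! ### Dimension, rank and residue field of the radical extension -/

section IntegralDimension

lemma ringKrullDim_le_of_isIntegral {R S : Type*} [CommRing R] [CommRing S] [Algebra R S]
    [Algebra.IsIntegral R S] (h : Function.Injective (algebraMap R S)) :
    ringKrullDim R ≤ ringKrullDim S := by
  refine iSup_le fun l => ?_
  obtain ⟨Q, -, hQ, hQl⟩ := Ideal.exists_ideal_over_prime_of_isIntegral l.head.asIdeal (⊥ : Ideal S)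
    (by
      rw [Ideal.comap_bot_of_injective _ h]
      exact bot_le)
  have : Q.LiesOver l.head.asIdeal := ⟨hQl.symm⟩
  obtain ⟨L, hL, -⟩ := Ideal.exists_ltSeries_of_hasGoingUp l Q
  rw [← hL]
  exact Order.LTSeries.length_le_krullDim L

end IntegralDimension

section FracDegree

lemma finrank_fractionRing_map {R S K L : Type*} [CommRing R] [IsDomain R] [CommRing S] [IsDomain S]
    [Algebra R S] [Algebra.IsIntegral R S] [Field K] [Field L] [Algebra R K] [Algebra S L]
    [IsFractionRing R K] [IsFractionRing S L] (h : Function.Injective (algebraMap R S)) :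
    letI : Algebra K L := (IsFractionRing.map (K := K) (L := L) h).toAlgebra
    Module.finrank K L = Module.finrank R S := by
  let _ : Algebra K L := (IsFractionRing.map (K := K) (L := L) h).toAlgebra
  let _ : Algebra R L := ((algebraMap S L).comp (algebraMap R S)).toAlgebra
  have : IsScalarTower R S L := IsScalarTower.of_algebraMap_eq fun _ => rfl
  have : IsScalarTower R K L := by
    refine IsScalarTower.of_algebraMap_eq fun x => ?_
    exact (IsLocalization.map_eq (M := nonZeroDivisors R) (S := K) (T := nonZeroDivisors S) (Q := L)
      (nonZeroDivisors_le_comap_nonZeroDivisors_of_injective _ h) x).symm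
  have : FaithfulSMul R S := (faithfulSMul_iff_algebraMap_injective R S).mpr h
  exact IsFractionRing.finrank_eq R K S L

/-- The degree `b` enters the asymptotics as the rank of `S` as an `R`-module. -/
lemma fracDegree_eq_finrank {R S : Type*} [CommRing R] [IsDomain R] [CommRing S] [IsDomain S]
    [Algebra R S] [Algebra.IsIntegral R S] (h : Function.Injective (algebraMap R S)) :
    fracDegree R S h = Module.finrank R S :=
  finrank_fractionRing_map h

end FracDegree

section RadicalExtension

open IsLocalRing

variable {R S : Type*} [CommRing R] [IsDomain R] [IsLocalRing R] [CommRing S] [IsDomain S]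
  [Algebra R S] {z : R} {n : ℕ} {v : S} (hS : IsRadicalExtension z n v)
include hS

lemma IsRadicalExtension.moduleFinite : Module.Finite R S := by
  have hv : IsIntegral R v := by
    refine IsIntegral.of_pow hS.pos ?_
    rw [hS.pow_eq]
    exact isIntegral_algebraMap
  have := hv.fg_adjoin_singleton
  rw [hS.adjoin_eq_top, Algebra.top_toSubmodule] at this
  exact ⟨this⟩

/-- As `v` generates `S`, the ring `S/vS` is a quotient of `R`. Hence `S` has the residue field of
`R`, and its maximal ideal is `vS + mS`. -/
lemma IsRadicalExtension.exists_sub_mem_span (x : S) :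
    ∃ a : R, x - algebraMap R S a ∈ Ideal.span {v} := by
  have hx : x ∈ Algebra.adjoin R {v} := hS.adjoin_eq_top ▸ Algebra.mem_top
  induction hx using Algebra.adjoin_induction with
  | mem x hx =>
    refine ⟨0, ?_⟩
    rw [Set.mem_singleton_iff.mp hx, map_zero, sub_zero]
    exact Ideal.mem_span_singleton_self v
  | algebraMap a => exact ⟨a, by simp⟩
  | add x y _ _ hx hy =>
    obtain ⟨a, ha⟩ := hx
    obtain ⟨b, hb⟩ := hy
    refine ⟨a + b, ?_⟩
    convert add_mem ha hb using 1
    rw [map_add]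
    ring
  | mul x y _ _ hx hy =>
    obtain ⟨a, ha⟩ := hx
    obtain ⟨b, hb⟩ := hy
    refine ⟨a * b, ?_⟩
    convert add_mem (Ideal.mul_mem_right y _ ha) (Ideal.mul_mem_left _ (algebraMap R S a) hb)
      using 1
    rw [map_mul]
    ring

lemma IsRadicalExtension.isLocalHom : IsLocalHom (algebraMap R S) := by
  have := hS.moduleFinite
  have : FaithfulSMul R S := (faithfulSMul_iff_algebraMap_injective R S).mpr hS.injective
  infer_instance

lemma IsRadicalExtension.isNoetherianRing [IsNoetherianRing R] : IsNoetherianRing S := by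
  have := hS.moduleFinite
  exact IsNoetherianRing.of_finite R S

variable [IsLocalRing S]

lemma IsRadicalExtension.generator_mem_maximalIdeal : v ∈ maximalIdeal S := by
  have := hS.isLocalHom
  have h1 : v ^ n ∈ maximalIdeal S := by
    rw [hS.pow_eq]
    exact map_nonunit _ _ hS.mem_maximalIdeal
  exact Ideal.IsPrime.mem_of_pow_mem inferInstance _ h1

lemma IsRadicalExtension.exists_sub_mem_maximalIdeal (x : S) :
    ∃ a : R, x - algebraMap R S a ∈ maximalIdeal S := by
  obtain ⟨a, ha⟩ := hS.exists_sub_mem_span x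
  refine ⟨a, Ideal.span_le.mpr ?_ ha⟩
  rw [Set.singleton_subset_iff]
  exact hS.generator_mem_maximalIdeal

lemma IsRadicalExtension.map_maximalIdeal_le :
    (maximalIdeal R).map (algebraMap R S) ≤ maximalIdeal S := by
  have := hS.isLocalHom
  exact ((local_hom_TFAE (algebraMap R S)).out 0 2).mp this

lemma IsRadicalExtension.maximalIdeal_eq :
    maximalIdeal S = Ideal.span {v} ⊔ (maximalIdeal R).map (algebraMap R S) := by
  have hloc := hS.isLocalHom
  have hv : Ideal.span {v} ≤ maximalIdeal S := by
    rw [Ideal.span_singleton_le_iff_mem]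
    exact hS.generator_mem_maximalIdeal
  apply le_antisymm
  · intro x hx
    obtain ⟨a, ha⟩ := hS.exists_sub_mem_span x
    have h1 : algebraMap R S a ∈ maximalIdeal S := by
      have := sub_mem hx (hv ha)
      rwa [sub_sub_cancel] at this
    have h2 : a ∈ maximalIdeal R := by
      by_contra h
      rw [IsLocalRing.mem_maximalIdeal, mem_nonunits_iff, not_not] at h
      exact h1 (h.map (algebraMap R S))
    have := add_mem (Ideal.mem_sup_left (T := (maximalIdeal R).map (algebraMap R S)) ha)
      (Ideal.mem_sup_right (S := Ideal.span {v}) (Ideal.mem_map_of_mem (algebraMap R S) h2))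
    rwa [sub_add_cancel] at this
  · exact sup_le hv hS.map_maximalIdeal_le

lemma IsRadicalExtension.natKrullDim_eq [IsNoetherianRing R] : natKrullDim S = natKrullDim R := by
  have := hS.moduleFinite
  have := hS.isNoetherianRing
  have h1 : ringKrullDim R ≤ ringKrullDim S := ringKrullDim_le_of_isIntegral hS.injective
  have h2 : ringKrullDim S ≤ ringKrullDim R := by
    refine ringKrullDim_le_of_maximalIdeal_le_radical hS.map_maximalIdeal_le ?_
    rw [hS.maximalIdeal_eq]
    refine sup_le ?_ Ideal.le_radical
    rw [Ideal.span_singleton_le_iff_mem]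
    refine ⟨n, ?_⟩
    rw [hS.pow_eq]
    exact Ideal.mem_map_of_mem _ hS.mem_maximalIdeal
  unfold natKrullDim
  rw [le_antisymm h1 h2]

end RadicalExtension

section ResidueRoots

open IsLocalRing

lemma exists_sub_pow_mem_maximalIdeal {R : Type*} [CommRing R] [IsLocalRing R]
    [IsAlgClosed (ResidueField R)] {p : ℕ} (hp : 0 < p) (x : R) :
    ∃ y : R, x - y ^ p ∈ maximalIdeal R := by
  obtain ⟨y, hy⟩ := IsAlgClosed.exists_pow_nat_eq (residue R x) hp
  obtain ⟨y, rfl⟩ := residue_surjective y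
  refine ⟨y, ?_⟩
  rw [← residue_eq_zero_iff, map_sub, map_pow, hy, sub_self]

end ResidueRoots

section FrobeniusMap

lemma map_iterateFrobenius_map {R S : Type*} [CommRing R] [CommRing S] [Algebra R S] {p : ℕ}
    [ExpChar R p] [ExpChar S p] (𝔞 : Ideal R) (k : ℕ) :
    (𝔞.map (iterateFrobenius R p k)).map (algebraMap R S) =
      (𝔞.map (algebraMap R S)).map (iterateFrobenius S p k) := by
  rw [Ideal.map_map, Ideal.map_map]
  congr 1
  ext x
  simp [iterateFrobenius_def]

end FrobeniusMap

/-! ### The inequality of multiplicities -/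

section RadicalMultiplicity

open IsLocalRing

variable {R S : Type*} [CommRing R] [IsDomain R] [IsLocalRing R] [IsNoetherianRing R]
  [CommRing S] [IsDomain S] [IsLocalRing S] [Algebra R S] {p : ℕ} [Fact p.Prime] [CharP R p]
  [CharP S p] {z : R} {n : ℕ} {v : S}

omit [IsNoetherianRing R] in
-- This is `colonLen_radical_le` for the Frobenius images of `v`, `r`, `IS` and `I₀S`, using `mS =
-- (v^n) + IS` and `n = (v) + IS`. Lengths over `R` and over `S` mix freely because the residue
-- fields agree.
lemma IsRadicalExtension.colonLen_frob_le (hS : IsRadicalExtension z n v) {I I₀ : Ideal R} {r : R}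
    (hI : maximalIdeal R = Ideal.span {z} ⊔ I) (hw : ∀ x ∈ maximalIdeal R, z * r * x ∈ I₀)
    (hvr : Ideal.span {v * algebraMap R S r} * I.map (algebraMap R S) ≤ I₀.map (algebraMap R S))
    (k : ℕ) :
    ((n - 1 : ℕ) : ℕ∞) * colonLen (I₀.map (iterateFrobenius R p k)) ((z * r) ^ p ^ k) S +
        n * colonLen ((maximalIdeal S).map (iterateFrobenius S p k)) (1 ^ p ^ k) S ≤
      n * colonLen ((maximalIdeal R).map (iterateFrobenius R p k)) (1 ^ p ^ k) S := by
  have hloc := hS.isLocalHom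
  have hres := hS.exists_sub_mem_maximalIdeal
  set F := iterateFrobenius S p k
  have hF : ∀ y : S, F y = y ^ p ^ k := fun y => iterateFrobenius_def p k y
  have hmR : (maximalIdeal R).map (algebraMap R S) =
      Ideal.span {v ^ n} ⊔ I.map (algebraMap R S) := by
    rw [hI, Ideal.map_sup, Ideal.map_span, Set.image_singleton, hS.pow_eq]
  have hmS : maximalIdeal S = Ideal.span {v} ⊔ I.map (algebraMap R S) := by
    rw [hS.maximalIdeal_eq, hmR, ← sup_assoc]
    congr 1
    refine sup_eq_left.mpr (Ideal.span_singleton_le_span_singleton.mpr ?_)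
    exact dvd_pow_self v hS.pos.ne'
  have hmain := colonLen_radical_le (n := n) (x := F v) (ρ := F (algebraMap R S r))
    (𝔦 := (I.map (algebraMap R S)).map F) (𝔧 := (I₀.map (algebraMap R S)).map F)
    (by
      intro y hy
      have h1 := Ideal.map_mono (f := F) hvr
      rw [Ideal.map_mul, Ideal.map_span, Set.image_singleton, map_mul] at h1
      exact h1 (Ideal.mul_mem_mul (Ideal.mem_span_singleton_self _) hy))
    (by
      rw [← map_pow, ← map_mul]
      refine Ideal.mem_map_of_mem F ?_
      -- `v^{2n} r = zr · z` lies in `I₀S` because `z ∈ m`.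
      have h1 := Ideal.mem_map_of_mem (algebraMap R S) (hw z hS.mem_maximalIdeal)
      convert h1 using 1
      rw [map_mul, map_mul, ← hS.pow_eq]
      ring)
  have h1 : colonLen (I₀.map (iterateFrobenius R p k)) ((z * r) ^ p ^ k) S =
      colonLen ((I₀.map (algebraMap R S)).map F) (F v ^ n * F (algebraMap R S r)) S := by
    rw [colonLen_map hloc hres, map_iterateFrobenius_map, ← map_pow F, ← map_mul F, hF,
      hS.pow_eq, ← map_mul, map_pow]
  have h2 : colonLen ((maximalIdeal S).map F) (1 ^ p ^ k) S =
      Module.length S (S ⧸ (Ideal.span {F v} ⊔ (I.map (algebraMap R S)).map F)) := by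
    rw [one_pow, colonLen_one, hmS, Ideal.map_sup, Ideal.map_span, Set.image_singleton]
  have h3 : colonLen ((maximalIdeal R).map (iterateFrobenius R p k)) (1 ^ p ^ k) S =
      Module.length S (S ⧸ (Ideal.span {F v ^ n} ⊔ (I.map (algebraMap R S)).map F)) := by
    rw [colonLen_map hloc hres, map_iterateFrobenius_map, hmR, one_pow, map_one, colonLen_one,
      Ideal.map_sup, Ideal.map_span, Set.image_singleton, map_pow F]
  rw [h1, h2, h3]
  exact hmain

lemma IsRadicalExtension.normLen_le (hS : IsRadicalExtension z n v) {I I₀ : Ideal R} {r : R}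
    (hI : maximalIdeal R = Ideal.span {z} ⊔ I) (hw : ∀ x ∈ maximalIdeal R, z * r * x ∈ I₀)
    (hvr : Ideal.span {v * algebraMap R S r} * I.map (algebraMap R S) ≤ I₀.map (algebraMap R S))
    (d k : ℕ) :
    ((n : ℝ) - 1) * normLen p d I₀ (z * r) S k + n * normLen p d (maximalIdeal S) 1 S k ≤
      n * normLen p d (maximalIdeal R) 1 S k := by
  have := hS.moduleFinite
  have := hS.isNoetherianRing
  have hp : 0 < p := (Fact.out : p.Prime).pos
  have h := hS.colonLen_frob_le (p := p) hI hw hvr k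
  have f1 := colonLen_frob_ne_top (M := S) hw hp k
  have f2 := colonLen_frob_ne_top (B := S) (w := 1) (M := S)
    (fun x (hx : x ∈ maximalIdeal S) => by rwa [one_mul]) hp k
  have f3 := colonLen_frob_ne_top (B := R) (w := 1) (M := S)
    (fun x (hx : x ∈ maximalIdeal R) => by rwa [one_mul]) hp k
  unfold normLen
  rw [← mul_div_assoc, ← mul_div_assoc, ← mul_div_assoc, ← add_div]
  refine div_le_div_of_nonneg_right ?_ (by positivity)
  obtain ⟨a, ha⟩ := ENat.ne_top_iff_exists.mp f1
  obtain ⟨b, hb⟩ := ENat.ne_top_iff_exists.mp f2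
  obtain ⟨c, hc⟩ := ENat.ne_top_iff_exists.mp f3
  rw [← ha, ← hb, ← hc] at h ⊢
  have h' : (n - 1) * a + n * b ≤ n * c := by exact_mod_cast h
  have h2 : (((n - 1) * a + n * b : ℕ) : ℝ) ≤ ((n * c : ℕ) : ℝ) := by exact_mod_cast h'
  simp only [ENat.toNat_natCast]
  rw [← Nat.cast_pred hS.pos]
  exact_mod_cast h2

/-- Lengths over `R` of quotients of a finite `R`-module are asymptotically those of a free
module of the same rank. -/
lemma tendsto_normLen_finrank_mul {M : Type*} [AddCommGroup M] [Module R M] [Module.Finite R M]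
    {I₀ : Ideal R} {w : R} (hw : ∀ x ∈ maximalIdeal R, w * x ∈ I₀) {e : ℝ}
    (he : Tendsto (normLen p (natKrullDim R) I₀ w R) atTop (𝓝 e)) :
    Tendsto (normLen p (natKrullDim R) I₀ w M) atTop (𝓝 (Module.finrank R M * e)) := by
  have hp : 1 < p := (Fact.out : p.Prime).one_lt
  obtain ⟨C, hC⟩ := exists_abs_normLen_sub_finrank_mul_le hw (zero_lt_one.trans hp)
    ringKrullDim_eq_natKrullDim.le (D := R) (N := M) Function.surjective_id
  exact tendsto_of_abs_sub_le_div hp hC (he.const_mul _)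

end RadicalMultiplicity

theorem mainTheorem8 {R S : Type*}
    [CommRing R] [IsDomain R] [IsLocalRing R] [IsNoetherianRing R]
    (p : ℕ) [Fact p.Prime] [CharP R p]
    [IsAlgClosed (IsLocalRing.ResidueField R)]
    [CommRing S] [IsDomain S] [IsLocalRing S] [Algebra R S]
    (z : R) (n : ℕ) (v : S) (hS : IsRadicalExtension z n v) (hn : 2 ≤ n)
    (I : Ideal R) (hzI : z ∉ I) (hI : IsLocalRing.maximalIdeal R = Ideal.span {z} ⊔ I)
    (r : R) (I₀ J : Ideal R) (hJ : J = Ideal.span {z * r} ⊔ I₀)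
    (hlen : idealQuotLength I₀ J = 1)
    (hvr : Ideal.span {v * algebraMap R S r} * I.map (algebraMap R S) ≤
      I₀.map (algebraMap R S)) :
    ∃ eRel eR eS : ℝ,
      IsRelHilbertKunzMultiplicity p I₀ J eRel ∧
      IsHilbertKunzMultiplicity p R eR ∧
      IsHilbertKunzMultiplicity p S eS ∧
      eRel ≤ (n : ℝ) / ((n : ℝ) - 1) * eR -
        (n : ℝ) / ((fracDegree R S hS.injective : ℝ) * ((n : ℝ) - 1)) * eS := by
  subst hJ
  have hp : 0 < p := (Fact.out : p.Prime).pos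
  have := hS.moduleFinite
  have := hS.isNoetherianRing
  have : FaithfulSMul R S := (faithfulSMul_iff_algebraMap_injective R S).mpr hS.injective
  have : CharP S p := charP_of_injective_algebraMap hS.injective p
  rw [idealQuotLength_span_singleton_sup] at hlen
  have hw := mul_mem_of_colonLen_eq_one hlen
  have hwR : ∀ x ∈ IsLocalRing.maximalIdeal R, (1 : R) * x ∈ IsLocalRing.maximalIdeal R :=
    fun x hx => by rwa [one_mul]
  have hwS : ∀ x ∈ IsLocalRing.maximalIdeal S, (1 : S) * x ∈ IsLocalRing.maximalIdeal S :=
    fun x hx => by rwa [one_mul]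
  have hperf : ∀ x : R, ∃ y : R, x - y ^ p ∈ IsLocalRing.maximalIdeal R :=
    exists_sub_pow_mem_maximalIdeal hp
  have hperfS : ∀ x : S, ∃ y : S, x - y ^ p ∈ IsLocalRing.maximalIdeal S := by
    intro x
    obtain ⟨a, ha⟩ := hS.exists_sub_mem_maximalIdeal x
    obtain ⟨y, hy⟩ := hperf a
    refine ⟨algebraMap R S y, ?_⟩
    have := add_mem ha (hS.map_maximalIdeal_le (Ideal.mem_map_of_mem (algebraMap R S) hy))
    rwa [map_sub, map_pow, sub_add_sub_cancel] at this
  obtain ⟨eRel, hRel⟩ := exists_tendsto_normLen (p := p) hperf hw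
  obtain ⟨eR, heR⟩ := exists_tendsto_normLen (p := p) hperf hwR
  obtain ⟨eS, heS⟩ := exists_tendsto_normLen (p := p) hperfS hwS
  refine ⟨eRel, eR, eS, isRelHilbertKunzMultiplicity_of_tendsto hp hw hRel,
    isHilbertKunzMultiplicity_of_tendsto hp heR, isHilbertKunzMultiplicity_of_tendsto hp heS, ?_⟩
  rw [fracDegree_eq_finrank]
  -- All three limits must carry the same normalization `q^{dim R}`.
  rw [hS.natKrullDim_eq] at heS
  have hb : (0 : ℝ) < Module.finrank R S := by
    have : Module.IsTorsionFree R S := inferInstance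
    exact_mod_cast Module.finrank_pos
  have hn1 : (0 : ℝ) < (n : ℝ) - 1 := by
    have : (2 : ℝ) ≤ n := by exact_mod_cast hn
    linarith
  -- In the limit: `(n-1) b e_HK(I₀, J) + n e_HK(S) ≤ n b e_HK(R)`, to be divided by `b (n-1) > 0`.
  have hlim := le_of_tendsto_of_tendsto'
    (((tendsto_normLen_finrank_mul (M := S) hw hRel).const_mul ((n : ℝ) - 1)).add
      (heS.const_mul (n : ℝ)))
    ((tendsto_normLen_finrank_mul (M := S) hwR heR).const_mul (n : ℝ))
    (hS.normLen_le hI hw hvr _)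
  have hrw : (n : ℝ) / ((n : ℝ) - 1) * eR - (n : ℝ) / ((Module.finrank R S : ℝ) * ((n : ℝ) - 1)) * eS
      = (n * (Module.finrank R S * eR) - n * eS) / ((Module.finrank R S : ℝ) * ((n : ℝ) - 1)) := by
    field_simp
  rw [hrw, le_div_iff₀ (mul_pos hb hn1)]
  linarith
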